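/- Let $D_x=-i\partial_x$, $D_y=-i\partial_y$, and let $H_0=(D_x+y)^2+D_y^2+x$ be the closure in $L^2(\mathbb R^2)$ of this differential operator with domain $C_0^\infty(\mathbb R^2)$. Put $r=(x^2+y^2)^{1/2}$ and $\langle r\rangle=(1+r^2)^{1/2}$. For every $\lambda\in\mathbb R$ with $|\lambda|\ge 1$ and every $0<\nu\le 1$ the point $\lambda+i\nu$ belongs to the resolvent set of $H_0$, and the following estimates hold for the operator norm on $L^2(\mathbb R^2)$. (i) For every $0<\theta\le 1/2$ there is a constant $C=C(\theta)>0$ such that for all $0<\delta\le 2$, all $0<\nu\le 1$ and all $\lambda\in\mathbb R$ with $|\lambda|\ge 1$, $$\left\|\langle r\rangle^{-\delta}(H_0-\lambda-i\nu)^{-1}\langle r\rangle^{-\delta}\right\|_{L^2\to L^2}\le C\,\nu^{-1}\left(|\lambda|^{-\theta}+(1+\nu)|\lambda|^{-1}+(1+\nu^{-2})|\lambda|^{\theta-1}\right)^{\delta/2}.$$ (ii) In particular, there is a constant $C>0$ such that for all $0<\delta\le 2$, all $0<\nu\le 1$ and all $\lambda\in\mathbb R$ with $|\lambda|\ge 1$,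 $$\left\|\langle r\rangle^{-\delta}(H_0-\lambda-i\nu)^{-1}\langle r\rangle^{-\delta}\right\|_{L^2\to L^2}\le C\,\nu^{-3}\,|\lambda|^{-\delta/4}.$$ -/

import Mathlib

open MeasureTheory
open scoped ContDiff

noncomputable section

namespace LandauStark

/-- The Hilbert space `L²(ℝ²; ℂ)`; a point of `ℝ × ℝ` is written `(x, y)`. -/
abbrev L2 : Type := Lp ℂ 2 (volume : Measure (ℝ × ℝ))

/-- `D_x = -i ∂_x`. -/
def Dx (φ : ℝ × ℝ → ℂ) (p : ℝ × ℝ) : ℂ := -Complex.I * fderiv ℝ φ p (1, 0)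

/-- `D_y = -i ∂_y`. -/
def Dy (φ : ℝ × ℝ → ℂ) (p : ℝ × ℝ) : ℂ := -Complex.I * fderiv ℝ φ p (0, 1)

/-- The first order differential operator `D_x + y`. -/
def DxAddY (φ : ℝ × ℝ → ℂ) (p : ℝ × ℝ) : ℂ := Dx φ p + (p.2 : ℂ) * φ p

/-- The differential expression `(D_x + y)² + D_y² + x`. -/
def expr (φ : ℝ × ℝ → ℂ) (p : ℝ × ℝ) : ℂ :=
  DxAddY (DxAddY φ) p + Dy (Dy φ) p + (p.1 : ℂ) * φ p

/-- The space `C₀^∞(ℝ²)` of complex valued smooth functions with compact support. -/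
def testSpace : Submodule ℂ (ℝ × ℝ → ℂ) where
  carrier := {φ | ContDiff ℝ ∞ φ ∧ HasCompactSupport φ}
  zero_mem' := ⟨contDiff_const, HasCompactSupport.zero⟩
  add_mem' := fun ha hb => ⟨ha.1.add hb.1, ha.2.add hb.2⟩
  smul_mem' := fun c _ ha => ⟨ha.1.const_smul c, ha.2.smul_left (f := fun _ => c)⟩

theorem Dx_mem {φ : ℝ × ℝ → ℂ} (h : φ ∈ testSpace) : Dx φ ∈ testSpace := by
  refine ⟨contDiff_const.mul ((h.1.fderiv_right (m := ∞) (by simp)).clm_apply contDiff_const), ?_⟩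
  exact (h.2.fderiv_apply (𝕜 := ℝ) (1, 0)).mul_left (f := fun _ => -Complex.I)

theorem Dy_mem {φ : ℝ × ℝ → ℂ} (h : φ ∈ testSpace) : Dy φ ∈ testSpace := by
  refine ⟨contDiff_const.mul ((h.1.fderiv_right (m := ∞) (by simp)).clm_apply contDiff_const), ?_⟩
  exact (h.2.fderiv_apply (𝕜 := ℝ) (0, 1)).mul_left (f := fun _ => -Complex.I)

theorem x_mul_mem {φ : ℝ × ℝ → ℂ} (h : φ ∈ testSpace) :
    (fun p => (p.1 : ℂ) * φ p) ∈ testSpace :=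
  ⟨(Complex.ofRealCLM.contDiff.comp contDiff_fst).mul h.1,
    h.2.mul_left (f := fun p : ℝ × ℝ => (p.1 : ℂ))⟩

theorem y_mul_mem {φ : ℝ × ℝ → ℂ} (h : φ ∈ testSpace) :
    (fun p => (p.2 : ℂ) * φ p) ∈ testSpace :=
  ⟨(Complex.ofRealCLM.contDiff.comp contDiff_snd).mul h.1,
    h.2.mul_left (f := fun p : ℝ × ℝ => (p.2 : ℂ))⟩

theorem DxAddY_mem {φ : ℝ × ℝ → ℂ} (h : φ ∈ testSpace) : DxAddY φ ∈ testSpace :=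
  testSpace.add_mem (Dx_mem h) (y_mul_mem h)

theorem expr_mem {φ : ℝ × ℝ → ℂ} (h : φ ∈ testSpace) : expr φ ∈ testSpace :=
  testSpace.add_mem (testSpace.add_mem (DxAddY_mem (DxAddY_mem h)) (Dy_mem (Dy_mem h)))
    (x_mul_mem h)

theorem differentiable_of_mem {φ : ℝ × ℝ → ℂ} (h : φ ∈ testSpace) : Differentiable ℝ φ :=
  h.1.differentiable (by simp)

theorem Dx_add {φ ψ : ℝ × ℝ → ℂ} (h : φ ∈ testSpace) (k : ψ ∈ testSpace) :
    Dx (φ + ψ) = Dx φ + Dx ψ := by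
  funext p
  simp only [Dx, Pi.add_apply, fderiv_add (differentiable_of_mem h p) (differentiable_of_mem k p),
    add_apply]
  ring

theorem Dx_smul (c : ℂ) {φ : ℝ × ℝ → ℂ} (h : φ ∈ testSpace) : Dx (c • φ) = c • Dx φ := by
  funext p
  simp only [Dx, Pi.smul_apply, fderiv_const_smul (differentiable_of_mem h p) c,
    smul_apply, smul_eq_mul]
  ring

theorem Dy_add {φ ψ : ℝ × ℝ → ℂ} (h : φ ∈ testSpace) (k : ψ ∈ testSpace) :
    Dy (φ + ψ) = Dy φ + Dy ψ := by
  funext p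
  simp only [Dy, Pi.add_apply, fderiv_add (differentiable_of_mem h p) (differentiable_of_mem k p),
    add_apply]
  ring

theorem Dy_smul (c : ℂ) {φ : ℝ × ℝ → ℂ} (h : φ ∈ testSpace) : Dy (c • φ) = c • Dy φ := by
  funext p
  simp only [Dy, Pi.smul_apply, fderiv_const_smul (differentiable_of_mem h p) c,
    smul_apply, smul_eq_mul]
  ring

theorem DxAddY_add {φ ψ : ℝ × ℝ → ℂ} (h : φ ∈ testSpace) (k : ψ ∈ testSpace) :
    DxAddY (φ + ψ) = DxAddY φ + DxAddY ψ := by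
  funext p
  simp only [DxAddY, Dx_add h k, Pi.add_apply]
  ring

theorem DxAddY_smul (c : ℂ) {φ : ℝ × ℝ → ℂ} (h : φ ∈ testSpace) :
    DxAddY (c • φ) = c • DxAddY φ := by
  funext p
  simp only [DxAddY, Dx_smul c h, Pi.smul_apply, smul_eq_mul]
  ring

theorem expr_add {φ ψ : ℝ × ℝ → ℂ} (h : φ ∈ testSpace) (k : ψ ∈ testSpace) :
    expr (φ + ψ) = expr φ + expr ψ := by
  funext p
  simp only [expr, DxAddY_add h k, DxAddY_add (DxAddY_mem h) (DxAddY_mem k), Dy_add h k,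
    Dy_add (Dy_mem h) (Dy_mem k), Pi.add_apply]
  ring

theorem expr_smul (c : ℂ) {φ : ℝ × ℝ → ℂ} (h : φ ∈ testSpace) :
    expr (c • φ) = c • expr φ := by
  funext p
  simp only [expr, DxAddY_smul c h, DxAddY_smul c (DxAddY_mem h), Dy_smul c h,
    Dy_smul c (Dy_mem h), Pi.smul_apply, smul_eq_mul]
  ring

/-- The differential expression as a linear map of `C₀^∞(ℝ²)` into itself. -/
def exprLin : testSpace →ₗ[ℂ] testSpace where
  toFun φ := ⟨expr φ, expr_mem φ.2⟩
  map_add' φ ψ := Subtype.ext (expr_add φ.2 ψ.2)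
  map_smul' c φ := Subtype.ext (expr_smul c φ.2)

theorem memLp_of_mem {φ : ℝ × ℝ → ℂ} (h : φ ∈ testSpace) : MemLp φ 2 volume :=
  h.1.continuous.memLp_of_hasCompactSupport h.2

/-- The embedding `C₀^∞(ℝ²) → L²(ℝ²)`. -/
def toL2 : testSpace →ₗ[ℂ] L2 where
  toFun φ := (memLp_of_mem φ.2).toLp φ
  map_add' φ ψ := MemLp.toLp_add (memLp_of_mem φ.2) (memLp_of_mem ψ.2)
  map_smul' c φ := MemLp.toLp_const_smul c (memLp_of_mem φ.2)

theorem toL2_injective : Function.Injective toL2 := by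
  intro φ ψ h
  have h' : (φ : ℝ × ℝ → ℂ) =ᵐ[volume] ψ :=
    (MemLp.toLp_eq_toLp_iff (memLp_of_mem φ.2) (memLp_of_mem ψ.2)).1 h
  exact Subtype.ext
    ((Continuous.ae_eq_iff_eq volume φ.2.1.continuous ψ.2.1.continuous).1 h')

/-- The operator `(D_x + y)² + D_y² + x` in `L²(ℝ²)` with domain `C₀^∞(ℝ²)`. -/
def H0min : L2 →ₗ.[ℂ] L2 where
  domain := LinearMap.range toL2
  toFun := toL2 ∘ₗ exprLin ∘ₗ (LinearEquiv.ofInjective toL2 toL2_injective).symm.toLinearMap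

/-- `H₀ = (D_x + y)² + D_y² + x`, the closure in `L²(ℝ²)` of the operator on `C₀^∞(ℝ²)`. -/
def H0 : L2 →ₗ.[ℂ] L2 := H0min.closure

/-- The bounded operator `R` is the resolvent `(T - z)⁻¹` of the unbounded operator `T`:
it maps into the domain of `T` and is a two-sided inverse of `T - z`. -/
structure IsResolvent {E : Type*} [NormedAddCommGroup E] [NormedSpace ℂ E]
    (T : E →ₗ.[ℂ] E) (z : ℂ) (R : E →L[ℂ] E) : Prop where
  mem_domain : ∀ f : E, R f ∈ T.domain
  right_inv : ∀ f : E, T ⟨R f, mem_domain f⟩ - z • R f = f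
  left_inv : ∀ u : T.domain, R (T u - z • (u : E)) = u

/-- There is at most one resolvent at a given point. -/
theorem IsResolvent.unique {E : Type*} [NormedAddCommGroup E] [NormedSpace ℂ E]
    {T : E →ₗ.[ℂ] E} {z : ℂ} {R S : E →L[ℂ] E} (hR : IsResolvent T z R)
    (hS : IsResolvent T z S) : R = S := by
  ext f
  have h := hS.left_inv ⟨R f, hR.mem_domain f⟩
  rw [hR.right_inv f] at h
  exact h.symm

/-- The distance `r = (x² + y²)^{1/2}` to the origin. -/
def radius (p : ℝ × ℝ) : ℝ := Real.sqrt (p.1 ^ 2 + p.2 ^ 2)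

/-- The Japanese bracket `⟨s⟩ = (1 + s²)^{1/2}`. -/
def bracket (s : ℝ) : ℝ := Real.sqrt (1 + s ^ 2)

/-- The weight `⟨r⟩^{-δ}`. -/
def weight (δ : ℝ) (p : ℝ × ℝ) : ℝ := bracket (radius p) ^ (-δ)

theorem one_le_bracket (s : ℝ) : 1 ≤ bracket s :=
  Real.one_le_sqrt.2 (by nlinarith [sq_nonneg s])

theorem weight_nonneg (δ : ℝ) (p : ℝ × ℝ) : 0 ≤ weight δ p :=
  Real.rpow_nonneg (zero_le_one.trans (one_le_bracket _)) _

theorem weight_le_one {δ : ℝ} (hδ : 0 ≤ δ) (p : ℝ × ℝ) : weight δ p ≤ 1 :=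
  Real.rpow_le_one_of_one_le_of_nonpos (one_le_bracket _) (neg_nonpos.2 hδ)

theorem measurable_weight (δ : ℝ) : Measurable (weight δ) := by
  unfold weight bracket radius
  fun_prop

theorem norm_weight_mul_le {δ : ℝ} (hδ : 0 ≤ δ) (p : ℝ × ℝ) (a : ℂ) :
    ‖(weight δ p : ℂ) * a‖ ≤ ‖a‖ := by
  rw [norm_mul, Complex.norm_real, Real.norm_of_nonneg (weight_nonneg δ p)]
  exact mul_le_of_le_one_left (norm_nonneg _) (weight_le_one hδ p)

theorem memLp_weight_mul {δ : ℝ} (hδ : 0 ≤ δ) (f : L2) :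
    MemLp (fun p => (weight δ p : ℂ) * f p) 2 volume :=
  (Lp.memLp f).mono
    ((Complex.measurable_ofReal.comp (measurable_weight δ)).aestronglyMeasurable.mul
      (Lp.aestronglyMeasurable f))
    (Filter.Eventually.of_forall fun p => norm_weight_mul_le hδ p (f p))

/-- For `δ ≥ 0`, multiplication by `⟨r⟩^{-δ}` as a bounded operator on `L²(ℝ²)`. -/
def weightOp (δ : ℝ) (hδ : 0 ≤ δ) : L2 →L[ℂ] L2 :=
  LinearMap.mkContinuous
    { toFun := fun f => (memLp_weight_mul hδ f).toLp _
      map_add' := fun f g => by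
        rw [← MemLp.toLp_add]
        refine MemLp.toLp_congr _ _ ?_
        filter_upwards [Lp.coeFn_add f g] with p hp
        simp only [hp, Pi.add_apply]
        ring
      map_smul' := fun c f => by
        rw [RingHom.id_apply, ← MemLp.toLp_const_smul]
        refine MemLp.toLp_congr _ _ ?_
        filter_upwards [Lp.coeFn_smul c f] with p hp
        simp only [hp, Pi.smul_apply, smul_eq_mul]
        ring }
    1
    (fun f => by
      rw [one_mul]
      refine Lp.norm_le_norm_of_ae_le ?_
      filter_upwards [(memLp_weight_mul hδ f).coeFn_toLp] with p hp
      simp only [LinearMap.coe_mk, AddHom.coe_mk, hp]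
      exact norm_weight_mul_le hδ p (f p))

end LandauStark

end

open MeasureTheory
open scoped ContDiff

noncomputable section

namespace LandauStark

/-! ### The algebra of test functions -/

/-- The algebra of real valued smooth functions on the plane. -/
def smoothFn : Subalgebra ℝ (ℝ × ℝ → ℝ) where
  carrier := {a | ContDiff ℝ ∞ a}
  mul_mem' := fun {a b} (ha : ContDiff ℝ ∞ a) (hb : ContDiff ℝ ∞ b) =>
    show ContDiff ℝ ∞ (a * b) from ha.mul hb
  add_mem' := fun {a b} (ha : ContDiff ℝ ∞ a) (hb : ContDiff ℝ ∞ b) =>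
    show ContDiff ℝ ∞ (a + b) from ha.add hb
  algebraMap_mem' := fun c => show ContDiff ℝ ∞ (fun _ : ℝ × ℝ => c) from contDiff_const

theorem mem_smoothFn {a : ℝ × ℝ → ℝ} : a ∈ smoothFn ↔ ContDiff ℝ ∞ a := Iff.rfl

theorem contDiff_smoothFn (a : smoothFn) : ContDiff ℝ ∞ a.1 := mem_smoothFn.1 a.2

/-- The standard basis of the plane. -/
def dir : Fin 2 → ℝ × ℝ := ![(1, 0), (0, 1)]

/-- The partial derivatives of a smooth function. -/
def pd (j : Fin 2) (a : smoothFn) : smoothFn :=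
  ⟨fun p => fderiv ℝ a.1 p (dir j),
    mem_smoothFn.2
      (((contDiff_smoothFn a).fderiv_right (m := ∞) (by simp)).clm_apply contDiff_const)⟩

/-- Multiplication of a test function by a smooth function. -/
def mulL (a : smoothFn) : testSpace →ₗ[ℂ] testSpace where
  toFun φ := ⟨fun p => (a.1 p : ℂ) * φ.1 p,
    (Complex.ofRealCLM.contDiff.comp (contDiff_smoothFn a)).mul φ.2.1,
    φ.2.2.mul_left (f := fun p : ℝ × ℝ => (a.1 p : ℂ))⟩
  map_add' φ ψ := Subtype.ext (funext fun p => mul_add (a.1 p : ℂ) (φ.1 p) (ψ.1 p))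
  map_smul' c φ := Subtype.ext (funext fun p => mul_left_comm (a.1 p : ℂ) c (φ.1 p))

theorem mulL_apply (a : smoothFn) (φ : testSpace) (p : ℝ × ℝ) :
    (mulL a φ).1 p = (a.1 p : ℂ) * φ.1 p := rfl

theorem test_ext {φ ψ : testSpace} (h : ∀ p, φ.1 p = ψ.1 p) : φ = ψ := Subtype.ext (funext h)

theorem test_add_apply (φ ψ : testSpace) (p : ℝ × ℝ) : (φ + ψ).1 p = φ.1 p + ψ.1 p := rfl

theorem test_smul_apply (c : ℂ) (φ : testSpace) (p : ℝ × ℝ) : (c • φ).1 p = c * φ.1 p := rfl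

theorem test_sub_apply (φ ψ : testSpace) (p : ℝ × ℝ) : (φ - ψ).1 p = φ.1 p - ψ.1 p := rfl

theorem mulL_mulL (a b : smoothFn) (φ : testSpace) : mulL a (mulL b φ) = mulL (a * b) φ :=
  test_ext fun p => by
    simp only [mulL_apply, MulMemClass.coe_mul, Pi.mul_apply, Complex.ofReal_mul]; ring

theorem mulL_one (φ : testSpace) : mulL 1 φ = φ :=
  test_ext fun p => by simp [mulL_apply]

/-- The operators `-i ∂_j` on test functions. -/
def derivL (j : Fin 2) : testSpace →ₗ[ℂ] testSpace where
  toFun φ := ⟨fun p => -Complex.I * fderiv ℝ φ.1 p (dir j),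
    contDiff_const.mul ((φ.2.1.fderiv_right (m := ∞) (by simp)).clm_apply contDiff_const),
    (φ.2.2.fderiv_apply (𝕜 := ℝ) (dir j)).mul_left (f := fun _ => -Complex.I)⟩
  map_add' φ ψ := test_ext fun p => by
    change -Complex.I * fderiv ℝ (φ.1 + ψ.1) p (dir j) = _ * _ + _ * _
    rw [fderiv_add (differentiable_of_mem φ.2 p) (differentiable_of_mem ψ.2 p)]
    simp only [add_apply]
    ring
  map_smul' c φ := test_ext fun p => by
    change -Complex.I * fderiv ℝ (c • φ.1) p (dir j) = c * (_ * _)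
    rw [fderiv_const_smul (differentiable_of_mem φ.2 p) c]
    simp only [smul_apply, smul_eq_mul]
    ring

/-- The coordinate `x`. -/
def coordX : smoothFn := ⟨fun p => p.1, mem_smoothFn.2 contDiff_fst⟩

/-- The coordinate `y`. -/
def coordY : smoothFn := ⟨fun p => p.2, mem_smoothFn.2 contDiff_snd⟩

/-- The vector potential. -/
def vecPot : Fin 2 → smoothFn := ![coordY, 0]

/-- The kinetic momenta `D_x + y` and `D_y`. -/
def mom (j : Fin 2) : testSpace →ₗ[ℂ] testSpace := derivL j + mulL (vecPot j)

theorem mom_apply (j : Fin 2) (φ : testSpace) (p : ℝ × ℝ) :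
    (mom j φ).1 p = -Complex.I * fderiv ℝ φ.1 p (dir j) + ((vecPot j).1 p : ℂ) * φ.1 p := rfl

theorem exprLin_eq (φ : testSpace) :
    exprLin φ = mom 0 (mom 0 φ) + mom 1 (mom 1 φ) + mulL coordX φ := by
  have h0 : ∀ φ : testSpace, (mom 0 φ).1 = DxAddY φ.1 := fun φ => funext fun p => by
    simp [mom_apply, DxAddY, Dx, dir, vecPot, coordY]
  have h1 : ∀ φ : testSpace, (mom 1 φ).1 = Dy φ.1 := fun φ => funext fun p => by
    simp [mom_apply, Dy, dir, vecPot]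
  refine test_ext fun p => ?_
  rw [test_add_apply, test_add_apply, h0, h0, h1, h1]
  rfl

theorem inner_toL2 (φ ψ : testSpace) :
    inner ℂ (toL2 φ) (toL2 ψ) = ∫ p, (starRingEnd ℂ) (φ.1 p) * ψ.1 p := by
  rw [L2.inner_def]
  refine integral_congr_ae ?_
  filter_upwards [(memLp_of_mem φ.2).coeFn_toLp, (memLp_of_mem ψ.2).coeFn_toLp] with p h1 h2
  change inner ℂ ((memLp_of_mem φ.2).toLp φ.1 p) ((memLp_of_mem ψ.2).toLp ψ.1 p) = _
  rw [h1, h2]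
  simp [mul_comm]

theorem inner_mulL (a : smoothFn) (φ ψ : testSpace) :
    inner ℂ (toL2 (mulL a φ)) (toL2 ψ) = inner ℂ (toL2 φ) (toL2 (mulL a ψ)) := by
  simp only [inner_toL2, mulL_apply, map_mul, Complex.conj_ofReal]
  congr 1; ext p; ring

theorem integrable_conj_mul (φ ψ : testSpace) :
    Integrable (fun p => (starRingEnd ℂ) (φ.1 p) * ψ.1 p) volume := by
  refine Continuous.integrable_of_hasCompactSupport ?_ ?_
  · exact (Complex.continuous_conj.comp φ.2.1.continuous).mul ψ.2.1.continuous
  · exact ψ.2.2.mul_left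

theorem fderiv_conj (φ : testSpace) (p v : ℝ × ℝ) :
    fderiv ℝ (fun q => (starRingEnd ℂ) (φ.1 q)) p v = (starRingEnd ℂ) (fderiv ℝ φ.1 p v) := by
  have h := (Complex.conjCLE.toContinuousLinearMap.hasFDerivAt).comp p
    (differentiable_of_mem φ.2 p).hasFDerivAt
  have h' : HasFDerivAt (fun q => (starRingEnd ℂ) (φ.1 q)) _ p := h
  rw [h'.fderiv]
  simp

theorem inner_derivL (j : Fin 2) (φ ψ : testSpace) :
    inner ℂ (toL2 (derivL j φ)) (toL2 ψ) = inner ℂ (toL2 φ) (toL2 (derivL j ψ)) := by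
  have hI : ∀ φ : testSpace, ∀ p, fderiv ℝ φ.1 p (dir j) = Complex.I * (derivL j φ).1 p := by
    intro φ p
    change _ = Complex.I * (-Complex.I * fderiv ℝ φ.1 p (dir j))
    rw [← mul_assoc]; simp
  have key := integral_mul_fderiv_eq_neg_fderiv_mul_of_integrable (μ := (volume : Measure (ℝ × ℝ)))
    (f := fun q => (starRingEnd ℂ) (φ.1 q)) (g := ψ.1) (v := dir j)
    (by
      simp only [fderiv_conj, hI, map_mul]
      refine ((integrable_conj_mul (derivL j φ) ψ).const_mul ((starRingEnd ℂ) Complex.I)).congr ?_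
      exact Filter.Eventually.of_forall fun p => by simp; ring)
    (by
      simp only [hI]
      refine ((integrable_conj_mul φ (derivL j ψ)).const_mul Complex.I).congr ?_
      exact Filter.Eventually.of_forall fun p => by simp; ring)
    (integrable_conj_mul φ ψ)
    (fun p _ => (Complex.conjCLE.toContinuousLinearMap.differentiableAt).comp p
      (differentiable_of_mem φ.2 p))
    (fun p _ => differentiable_of_mem ψ.2 p)
  simp only [fderiv_conj, hI, map_mul, Complex.conj_I] at key
  have e1 : ∀ p, (starRingEnd ℂ) (φ.1 p) * (Complex.I * (derivL j ψ).1 p)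
      = Complex.I * ((starRingEnd ℂ) (φ.1 p) * (derivL j ψ).1 p) := fun p => by ring
  have e2 : ∀ p, -Complex.I * (starRingEnd ℂ) ((derivL j φ).1 p) * ψ.1 p
      = -Complex.I * ((starRingEnd ℂ) ((derivL j φ).1 p) * ψ.1 p) := fun p => by ring
  simp only [e1, e2, integral_const_mul] at key
  rw [neg_mul, neg_neg] at key
  rw [inner_toL2, inner_toL2]
  exact (mul_left_cancel₀ Complex.I_ne_zero key).symm

theorem inner_mom (j : Fin 2) (φ ψ : testSpace) :
    inner ℂ (toL2 (mom j φ)) (toL2 ψ) = inner ℂ (toL2 φ) (toL2 (mom j ψ)) := by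
  simp only [mom, LinearMap.add_apply, map_add, inner_add_left, inner_add_right, inner_derivL,
    inner_mulL]

theorem inner_exprLin (φ ψ : testSpace) :
    inner ℂ (toL2 (exprLin φ)) (toL2 ψ) = inner ℂ (toL2 φ) (toL2 (exprLin ψ)) := by
  simp only [exprLin_eq, map_add, inner_add_left, inner_add_right, inner_mom, inner_mulL]

theorem mom_mulL (j : Fin 2) (a : smoothFn) (φ : testSpace) :
    mom j (mulL a φ) = (-Complex.I) • mulL (pd j a) φ + mulL a (mom j φ) := by
  refine test_ext fun p => ?_
  have ha : DifferentiableAt ℝ a.1 p := ((contDiff_smoothFn a).differentiable (by simp)) p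
  have h : HasFDerivAt (mulL a φ).1 _ p :=
    (Complex.ofRealCLM.hasFDerivAt.comp p ha.hasFDerivAt).mul
      (differentiable_of_mem φ.2 p).hasFDerivAt
  rw [mom_apply, h.fderiv, test_add_apply, test_smul_apply, mulL_apply, mulL_apply, mulL_apply,
    mom_apply]
  simp [pd]
  ring

/-- The constants `c` with `[P_k, P_j] = i c`. -/
def magn : Fin 2 → Fin 2 → ℝ := ![![0, 1], ![-1, 0]]

theorem derivL_comm (j k : Fin 2) (φ : testSpace) :
    derivL k (derivL j φ) = derivL j (derivL k φ) := by
  refine test_ext fun p => ?_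
  have h2 : ∀ v w : ℝ × ℝ, fderiv ℝ (fun q => -Complex.I * fderiv ℝ φ.1 q v) p w =
      -Complex.I * fderiv ℝ (fderiv ℝ φ.1) p w v := by
    intro v w
    have hd : DifferentiableAt ℝ (fderiv ℝ φ.1) p :=
      ((φ.2.1.fderiv_right (m := ∞) (by simp)).differentiable (by simp)) p
    rw [fderiv_const_mul (hd.clm_apply (differentiableAt_const v)),
      fderiv_clm_apply hd (differentiableAt_const v)]
    simp
  have hs : IsSymmSndFDerivAt ℝ φ.1 p :=
    (φ.2.1.contDiffAt (x := p)).isSymmSndFDerivAt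
      (by
        simp only [minSmoothness_of_isRCLikeNormedField]
        exact WithTop.coe_le_coe.2 (le_top : (2 : ℕ∞) ≤ ⊤))
  change -Complex.I * fderiv ℝ (fun q => -Complex.I * fderiv ℝ φ.1 q (dir j)) p (dir k) =
    -Complex.I * fderiv ℝ (fun q => -Complex.I * fderiv ℝ φ.1 q (dir k)) p (dir j)
  rw [h2, h2, hs (dir j) (dir k)]

theorem derivL_mulL (j : Fin 2) (a : smoothFn) (φ : testSpace) :
    derivL j (mulL a φ) = (-Complex.I) • mulL (pd j a) φ + mulL a (derivL j φ) := by
  have h := mom_mulL j a φ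
  simp only [mom, LinearMap.add_apply, map_add, mulL_mulL, mul_comm (vecPot j) a, ← add_assoc] at h
  exact add_right_cancel h

theorem pd_coordY (j : Fin 2) (p : ℝ × ℝ) : (pd j coordY).1 p = (dir j).2 := by
  change fderiv ℝ (fun q : ℝ × ℝ => q.2) p (dir j) = _
  rw [fderiv_snd]; rfl

theorem pd_coordX (j : Fin 2) (p : ℝ × ℝ) : (pd j coordX).1 p = (dir j).1 := by
  change fderiv ℝ (fun q : ℝ × ℝ => q.1) p (dir j) = _
  rw [fderiv_fst]; rfl

theorem mom_comm (j k : Fin 2) (φ : testSpace) :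
    mom k (mom j φ) = mom j (mom k φ) + (Complex.I * (magn k j : ℂ)) • φ := by
  have h01 : mom 0 (mom 1 φ) = mom 1 (mom 0 φ) + Complex.I • φ := by
    simp only [mom, LinearMap.add_apply, map_add, derivL_mulL, derivL_comm 1 0, mulL_mulL]
    refine test_ext fun p => ?_
    have h1 := pd_coordY 1 p
    have h2 : (pd 0 (0 : smoothFn)).1 p = 0 := by
      change fderiv ℝ (fun _ : ℝ × ℝ => (0 : ℝ)) p (dir 0) = 0
      simp
    simp only [test_add_apply, test_smul_apply, mulL_apply, vecPot, Matrix.cons_val_zero,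
      Matrix.cons_val_one, h1, h2, dir]
    simp
    ring
  fin_cases j <;> fin_cases k
  · simp [magn]
  · simp [magn, h01, add_assoc, ← add_smul]
  · simp [magn, h01]
  · simp [magn]

/-! ### Pointwise estimates -/

theorem norm_toL2_le_of_pointwise {φ ψ : testSpace} {c : ℝ} (h : ∀ p, ‖φ.1 p‖ ≤ c * ‖ψ.1 p‖) :
    ‖toL2 φ‖ ≤ c * ‖toL2 ψ‖ := by
  refine Lp.norm_le_mul_norm_of_ae_le_mul ?_
  filter_upwards [(memLp_of_mem φ.2).coeFn_toLp, (memLp_of_mem ψ.2).coeFn_toLp] with p h1 h2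
  change ‖(memLp_of_mem φ.2).toLp φ.1 p‖ ≤ c * ‖(memLp_of_mem ψ.2).toLp ψ.1 p‖
  rw [h1, h2]
  exact h p

theorem norm_mulL_le_mulL {a b : smoothFn} {c : ℝ} (h : ∀ p, |a.1 p| ≤ c * |b.1 p|)
    (φ : testSpace) : ‖toL2 (mulL a φ)‖ ≤ c * ‖toL2 (mulL b φ)‖ := by
  refine norm_toL2_le_of_pointwise fun p => ?_
  simp only [mulL_apply, norm_mul, Complex.norm_real, Real.norm_eq_abs, ← mul_assoc]
  exact mul_le_mul_of_nonneg_right (h p) (norm_nonneg _)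

theorem norm_mulL_le {a : smoothFn} {c : ℝ} (h : ∀ p, |a.1 p| ≤ c) (φ : testSpace) :
    ‖toL2 (mulL a φ)‖ ≤ c * ‖toL2 φ‖ := by
  have := norm_mulL_le_mulL (a := a) (b := 1) (c := c) (by simpa using h) φ
  rwa [mulL_one] at this

theorem inner_mulL_self (a : smoothFn) (φ : testSpace) :
    inner ℂ (toL2 (mulL a φ)) (toL2 φ) = ((∫ p, a.1 p * ‖φ.1 p‖ ^ 2 : ℝ) : ℂ) := by
  rw [inner_toL2, ← integral_complex_ofReal]
  congr 1; ext p
  rw [mulL_apply, map_mul, Complex.conj_ofReal, mul_assoc, mul_comm ((starRingEnd ℂ) _),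
    Complex.mul_conj, Complex.normSq_eq_norm_sq]
  push_cast; ring

/-- The quadratic form of a multiplication operator. -/
def quad (a : smoothFn) (φ : testSpace) : ℝ := ∫ p, a.1 p * ‖φ.1 p‖ ^ 2

theorem inner_mulL_eq_quad (a : smoothFn) (φ : testSpace) :
    inner ℂ (toL2 (mulL a φ)) (toL2 φ) = (quad a φ : ℂ) := inner_mulL_self a φ

theorem integrable_quad (a : smoothFn) (φ : testSpace) :
    Integrable (fun p => a.1 p * ‖φ.1 p‖ ^ 2) volume := by
  have ha : Continuous a.1 := (contDiff_smoothFn a).continuous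
  refine Continuous.integrable_of_hasCompactSupport
    (ha.mul (φ.2.1.continuous.norm.pow 2)) ?_
  have : HasCompactSupport fun p => ‖φ.1 p‖ ^ 2 :=
    φ.2.2.comp_left (g := fun z : ℂ => ‖z‖ ^ 2) (by simp)
  exact this.mul_left

theorem quad_mono {a b : smoothFn} (h : ∀ p, a.1 p ≤ b.1 p) (φ : testSpace) :
    quad a φ ≤ quad b φ :=
  integral_mono (integrable_quad a φ) (integrable_quad b φ) fun p =>
    mul_le_mul_of_nonneg_right (h p) (by positivity)

theorem quad_add (a b : smoothFn) (φ : testSpace) : quad (a + b) φ = quad a φ + quad b φ := by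
  unfold quad
  rw [← integral_add (integrable_quad a φ) (integrable_quad b φ)]
  congr 1; ext p
  simp [add_mul]

theorem quad_smul (c : ℝ) (a : smoothFn) (φ : testSpace) : quad (c • a) φ = c * quad a φ := by
  unfold quad
  rw [← integral_const_mul]
  congr 1; ext p
  simp [mul_assoc]

theorem quad_mul_self (a : smoothFn) (φ : testSpace) : quad (a * a) φ = ‖toL2 (mulL a φ)‖ ^ 2 := by
  have h : (quad (a * a) φ : ℂ) = (‖toL2 (mulL a φ)‖ ^ 2 : ℝ) := by
    rw [← inner_mulL_eq_quad, ← mulL_mulL, inner_mulL]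
    simp
  exact_mod_cast h

theorem quad_one (φ : testSpace) : quad 1 φ = ‖toL2 φ‖ ^ 2 := by
  have := quad_mul_self 1 φ
  rwa [mulL_one, one_mul] at this

theorem abs_quad_le {a : smoothFn} {c : ℝ} (h : ∀ p, |a.1 p| ≤ c) (φ : testSpace) :
    |quad a φ| ≤ c * ‖toL2 φ‖ ^ 2 := by
  rw [← quad_one, ← quad_smul]
  refine abs_le.2 ⟨?_, quad_mono (fun p => ?_) φ⟩
  · have := quad_mono (a := (-c) • (1 : smoothFn)) (b := a)
      (fun p => by simpa using (abs_le.1 (h p)).1) φ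
    rw [quad_smul] at this ⊢
    linarith
  · simpa using (abs_le.1 (h p)).2

theorem norm_inner_mulL_le {a b : smoothFn} {c : ℝ} (h : ∀ p, |a.1 p| ≤ c * |b.1 p|)
    (φ ψ : testSpace) :
    ‖inner ℂ (toL2 (mulL a φ)) (toL2 ψ)‖ ≤ c * ‖toL2 φ‖ * ‖toL2 (mulL b ψ)‖ := by
  rw [inner_mulL]
  refine (norm_inner_le_norm _ _).trans ?_
  have := mul_le_mul_of_nonneg_left (norm_mulL_le_mulL h ψ) (norm_nonneg (toL2 φ))
  linarith

theorem inner_conj_toL2 (φ ψ : testSpace) :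
    (starRingEnd ℂ) (inner ℂ (toL2 φ) (toL2 ψ)) = inner ℂ (toL2 ψ) (toL2 φ) :=
  inner_conj_symm _ _

/-! ### Energy and virial identities -/

/-- `(H - z) u` for a test function `u`. -/
def shifted (z : ℂ) (u : testSpace) : testSpace := exprLin u - z • u

theorem inner_mulL_mom_mom (a : smoothFn) (k : Fin 2) (u : testSpace) :
    inner ℂ (toL2 (mulL a u)) (toL2 (mom k (mom k u))) =
      (quad a (mom k u) : ℂ) +
        Complex.I * inner ℂ (toL2 (mulL (pd k a) u)) (toL2 (mom k u)) := by
  rw [← inner_mom, mom_mulL, map_add, inner_add_left, map_smul, inner_smul_left,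
    inner_mulL_eq_quad, map_neg, Complex.conj_I, neg_neg, add_comm]

theorem inner_mulL_coordX (a : smoothFn) (u : testSpace) :
    inner ℂ (toL2 (mulL a u)) (toL2 (mulL coordX u)) = (quad (coordX * a) u : ℂ) := by
  rw [← inner_mulL, mulL_mulL, inner_mulL_eq_quad]

theorem inner_mulL_shifted (a : smoothFn) (z : ℂ) (u : testSpace) :
    inner ℂ (toL2 (mulL a u)) (toL2 (shifted z u)) =
      ((quad a (mom 0 u) + quad a (mom 1 u) + quad (coordX * a) u : ℝ) : ℂ) - z * (quad a u : ℂ) +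
        Complex.I * (inner ℂ (toL2 (mulL (pd 0 a) u)) (toL2 (mom 0 u)) +
          inner ℂ (toL2 (mulL (pd 1 a) u)) (toL2 (mom 1 u))) := by
  rw [shifted, exprLin_eq]
  simp only [map_sub, map_add, inner_sub_right, inner_add_right, map_smul, inner_smul_right,
    inner_mulL_mom_mom, inner_mulL_coordX, inner_mulL_eq_quad]
  push_cast
  ring

theorem local_energy (a : smoothFn) (z : ℂ) (u : testSpace) :
    quad a (mom 0 u) + quad a (mom 1 u) =
      (inner ℂ (toL2 (mulL a u)) (toL2 (shifted z u))).re + z.re * quad a u -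
        quad (coordX * a) u + (inner ℂ (toL2 (mulL (pd 0 a) u)) (toL2 (mom 0 u))).im +
        (inner ℂ (toL2 (mulL (pd 1 a) u)) (toL2 (mom 1 u))).im := by
  rw [inner_mulL_shifted]
  simp only [Complex.add_re, Complex.sub_re, Complex.mul_re, Complex.ofReal_re, Complex.ofReal_im,
    Complex.I_re, Complex.I_im, Complex.add_im]
  ring

theorem local_flux (a : smoothFn) (z : ℂ) (u : testSpace) :
    z.im * quad a u =
      -(inner ℂ (toL2 (mulL a u)) (toL2 (shifted z u))).im +
        (inner ℂ (toL2 (mulL (pd 0 a) u)) (toL2 (mom 0 u))).re +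
        (inner ℂ (toL2 (mulL (pd 1 a) u)) (toL2 (mom 1 u))).re := by
  rw [inner_mulL_shifted]
  simp only [Complex.add_im, Complex.sub_im, Complex.mul_im, Complex.ofReal_re, Complex.ofReal_im,
    Complex.I_re, Complex.I_im, Complex.add_re]
  ring

theorem inner_shifted_self (z : ℂ) (u : testSpace) :
    z.im * ‖toL2 u‖ ^ 2 = -(inner ℂ (toL2 u) (toL2 (shifted z u))).im := by
  have h := local_flux 1 z u
  have h1 : ∀ k, pd k (1 : smoothFn) = 0 := fun k => Subtype.ext (funext fun p => by
    change fderiv ℝ (fun _ : ℝ × ℝ => (1 : ℝ)) p (dir k) = 0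
    simp)
  have h0 : ∀ φ : testSpace, mulL 0 φ = 0 := fun φ => test_ext fun p => by simp [mulL_apply]
  rw [mulL_one, quad_one, h1, h1, h0, map_zero] at h
  simpa using h

theorem im_inner_mulL_mom_self (b : smoothFn) (j : Fin 2) (w : testSpace) :
    (inner ℂ (toL2 (mulL b (mom j w))) (toL2 w)).im = -(1 / 2) * quad (pd j b) w := by
  have h : inner ℂ (toL2 (mulL b (mom j w))) (toL2 w) = -Complex.I * (quad (pd j b) w : ℂ) +
      (starRingEnd ℂ) (inner ℂ (toL2 (mulL b (mom j w))) (toL2 w)) := by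
    conv_lhs => rw [inner_mulL, inner_mom, mom_mulL, map_add, inner_add_right, map_smul,
      inner_smul_right, ← inner_mulL, inner_mulL_eq_quad]
    rw [inner_conj_toL2]
  have h' := congrArg Complex.im h
  simp only [Complex.add_im, Complex.conj_im, Complex.mul_im, Complex.neg_re, Complex.neg_im,
    Complex.I_re, Complex.I_im, Complex.ofReal_re, Complex.ofReal_im] at h'
  linarith

theorem im_inner_mulL_mom_mom_mom (b : smoothFn) (j k : Fin 2) (u : testSpace) :
    (inner ℂ (toL2 (mulL b (mom j u))) (toL2 (mom k (mom k u)))).im =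
      (inner ℂ (toL2 (mulL (pd k b) (mom j u))) (toL2 (mom k u))).re -
        1 / 2 * quad (pd j b) (mom k u) -
        magn k j * (inner ℂ (toL2 (mulL b u)) (toL2 (mom k u))).re := by
  rw [← inner_mom, mom_mulL, mom_comm, map_add, map_add, inner_add_left, map_smul, map_add,
    inner_add_left, map_smul, map_smul, inner_smul_left, inner_smul_left, Complex.add_im,
    Complex.add_im, im_inner_mulL_mom_self]
  simp
  ring

/-- The symmetrized first order multiplier `(b P_j + P_j b) / 2`. -/
def multiplier (j : Fin 2) (b : smoothFn) (u : testSpace) : testSpace :=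
  mulL b (mom j u) - (Complex.I / 2) • mulL (pd j b) u

theorem inner_multiplier (j : Fin 2) (b : smoothFn) (u ψ : testSpace) :
    inner ℂ (toL2 (multiplier j b u)) (toL2 ψ) = inner ℂ (toL2 (mulL b (mom j u))) (toL2 ψ) +
      Complex.I / 2 * inner ℂ (toL2 (mulL (pd j b) u)) (toL2 ψ) := by
  rw [multiplier, map_sub, inner_sub_left, map_smul, inner_smul_left, map_div₀, Complex.conj_I,
    map_ofNat]
  ring

theorem pd_mul (j : Fin 2) (a b : smoothFn) : pd j (a * b) = pd j a * b + a * pd j b := by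
  refine Subtype.ext (funext fun p => ?_)
  change fderiv ℝ (a.1 * b.1) p (dir j) =
    fderiv ℝ a.1 p (dir j) * b.1 p + a.1 p * fderiv ℝ b.1 p (dir j)
  rw [fderiv_mul ((contDiff_smoothFn a).differentiable (by simp) p)
    ((contDiff_smoothFn b).differentiable (by simp) p)]
  simp
  ring

theorem im_inner_multiplier_mulL (j : Fin 2) (b c : smoothFn) (u : testSpace) :
    (inner ℂ (toL2 (multiplier j b u)) (toL2 (mulL c u))).im =
      -(1 / 2) * quad (pd j c * b) u := by
  rw [inner_multiplier, ← inner_mulL, ← inner_mulL, mulL_mulL, mulL_mulL, inner_mulL_eq_quad,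
    Complex.add_im, im_inner_mulL_mom_self, pd_mul, quad_add]
  simp
  ring

theorem im_inner_multiplier_self (j : Fin 2) (b : smoothFn) (u : testSpace) :
    (inner ℂ (toL2 (multiplier j b u)) (toL2 u)).im = 0 := by
  rw [inner_multiplier, inner_mulL_eq_quad, Complex.add_im, im_inner_mulL_mom_self]
  simp

theorem im_inner_multiplier_mom_mom (j k : Fin 2) (b : smoothFn) (u : testSpace) :
    (inner ℂ (toL2 (multiplier j b u)) (toL2 (mom k (mom k u)))).im =
      (inner ℂ (toL2 (mulL (pd k b) (mom j u))) (toL2 (mom k u))).re -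
        1 / 2 * (inner ℂ (toL2 (mulL (pd k (pd j b)) u)) (toL2 (mom k u))).im -
        magn k j * (inner ℂ (toL2 (mulL b u)) (toL2 (mom k u))).re := by
  rw [inner_multiplier, Complex.add_im, im_inner_mulL_mom_mom_mom, inner_mulL_mom_mom]
  simp
  ring

theorem virial (j : Fin 2) (b : smoothFn) (z : ℂ) (u : testSpace) :
    (inner ℂ (toL2 (multiplier j b u)) (toL2 (shifted z u))).im =
      (∑ k, ((inner ℂ (toL2 (mulL (pd k b) (mom j u))) (toL2 (mom k u))).re -
        1 / 2 * (inner ℂ (toL2 (mulL (pd k (pd j b)) u)) (toL2 (mom k u))).im -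
        magn k j * (inner ℂ (toL2 (mulL b u)) (toL2 (mom k u))).re)) -
      1 / 2 * quad (pd j coordX * b) u -
      z.im * (inner ℂ (toL2 (multiplier j b u)) (toL2 u)).re := by
  rw [shifted, exprLin_eq]
  simp only [map_sub, map_add, inner_sub_right, inner_add_right, map_smul, inner_smul_right,
    Complex.add_im, Complex.sub_im, Complex.mul_im, im_inner_multiplier_mom_mom,
    im_inner_multiplier_self, im_inner_multiplier_mulL, Fin.sum_univ_two]
  ring

/-! ### The weighted estimate for test functions -/

/-- The weight functions used in the virial argument at energy scale `L`. -/
structure Admissible (L c : ℝ) (χ η : smoothFn) (b : Fin 2 → smoothFn) : Prop where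
  one_le : 1 ≤ c
  abs_χ : ∀ p, |χ.1 p| ≤ 1
  abs_η : ∀ p, |η.1 p| ≤ 1
  abs_pd_sq : ∀ k p, |(pd k (η * η)).1 p| ≤ c * |η.1 p|
  abs_x_sq : ∀ p, |(coordX * (η * η)).1 p| ≤ L
  abs_pd_q : ∀ k p, |(pd k (χ * η * (χ * η))).1 p| ≤ c * |η.1 p|
  abs_x_q : ∀ p, |(coordX * (χ * η * (χ * η))).1 p| ≤ c
  χ_le : ∀ p, (χ * χ).1 p ≤ (χ * η * (χ * η) + (c / L) • (1 : smoothFn)).1 p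
  abs_b : ∀ j p, |(b j).1 p| ≤ c * |η.1 p|
  abs_pd_b : ∀ j p, |(pd j (b j)).1 p| ≤ c
  le_pd_b : ∀ j p, (χ * η * (χ * η)).1 p ≤ (pd j (b j) + (c / L) • (η * η)).1 p
  abs_pd_cross : ∀ j k, k ≠ j → ∀ p, |(pd k (b j)).1 p| ≤ c / L * (η * η).1 p
  abs_pd_pd : ∀ j k p, |(pd k (pd j (b j))).1 p| ≤ c * |η.1 p|

theorem norm_inner_mulL_le_sq {a η : smoothFn} {c : ℝ} (h : ∀ p, |a.1 p| ≤ c * (η * η).1 p)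
    (φ ψ : testSpace) :
    ‖inner ℂ (toL2 (mulL a φ)) (toL2 ψ)‖ ≤
      c / 2 * (‖toL2 (mulL η φ)‖ ^ 2 + ‖toL2 (mulL η ψ)‖ ^ 2) := by
  rw [← quad_mul_self, ← quad_mul_self, inner_toL2, quad, quad,
    ← integral_add (integrable_quad _ φ) (integrable_quad _ ψ), ← integral_const_mul]
  refine norm_integral_le_of_norm_le
    (((integrable_quad _ φ).add (integrable_quad _ ψ)).const_mul _)
    (Filter.Eventually.of_forall fun p => ?_)
  rw [mulL_apply, norm_mul, RCLike.norm_conj, norm_mul, Complex.norm_real, Real.norm_eq_abs]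
  have h1 := h p
  have h0 : 0 ≤ c * (η * η).1 p := (abs_nonneg _).trans h1
  have h2 : ‖φ.1 p‖ * ‖ψ.1 p‖ ≤ (‖φ.1 p‖ ^ 2 + ‖ψ.1 p‖ ^ 2) / 2 := by
    nlinarith [sq_nonneg (‖φ.1 p‖ - ‖ψ.1 p‖)]
  calc |a.1 p| * ‖φ.1 p‖ * ‖ψ.1 p‖ = |a.1 p| * (‖φ.1 p‖ * ‖ψ.1 p‖) := by ring
    _ ≤ c * (η * η).1 p * ((‖φ.1 p‖ ^ 2 + ‖ψ.1 p‖ ^ 2) / 2) :=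
        mul_le_mul h1 h2 (by positivity) h0
    _ = _ := by ring

theorem abs_magn_le (k j : Fin 2) : |magn k j| ≤ 1 := by
  fin_cases k <;> fin_cases j <;> simp [magn]

section

variable {L c : ℝ} {χ η : smoothFn} {b : Fin 2 → smoothFn}

theorem Admissible.norm_multiplier_le (W : Admissible L c χ η b) (j : Fin 2) (u : testSpace) :
    ‖toL2 (multiplier j (b j) u)‖ ≤ c * ‖toL2 (mulL η (mom j u))‖ + c * ‖toL2 u‖ := by
  rw [multiplier, map_sub, map_smul]
  refine (norm_sub_le _ _).trans (add_le_add (norm_mulL_le_mulL (W.abs_b j) _) ?_)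
  rw [norm_smul]
  have h := norm_mulL_le (W.abs_pd_b j) u
  have : ‖Complex.I / 2‖ = 1 / 2 := by simp
  rw [this]
  linarith [norm_nonneg (toL2 (mulL (pd j (b j)) u))]

theorem Admissible.norm_mulL_multiplier_le (W : Admissible L c χ η b) (j : Fin 2)
    (u : testSpace) :
    ‖toL2 (mulL χ (multiplier j (b j) u))‖ ≤
      c * ‖toL2 (mulL (χ * η) (mom j u))‖ + c * ‖toL2 (mulL χ u)‖ := by
  rw [multiplier, map_sub, map_sub, map_smul, map_smul, mulL_mulL, mulL_mulL]
  refine (norm_sub_le _ _).trans (add_le_add (norm_mulL_le_mulL (fun p => ?_) _) ?_)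
  · simp only [MulMemClass.coe_mul, Pi.mul_apply, abs_mul]
    have := mul_le_mul_of_nonneg_left (W.abs_b j p) (abs_nonneg (χ.1 p))
    linarith
  · rw [norm_smul]
    have h := norm_mulL_le_mulL (a := χ * pd j (b j)) (b := χ) (c := c) (fun p => by
      simp only [MulMemClass.coe_mul, Pi.mul_apply, abs_mul]
      have := mul_le_mul_of_nonneg_left (W.abs_pd_b j p) (abs_nonneg (χ.1 p))
      linarith) u
    have : ‖Complex.I / 2‖ = 1 / 2 := by simp
    rw [this]
    linarith [norm_nonneg (toL2 (mulL (χ * pd j (b j)) u))]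

theorem Admissible.virial_le (W : Admissible L c χ η b) (hL : 1 ≤ L) {z : ℂ} (hz : 0 < z.im)
    (hz1 : z.im ≤ 1) (j : Fin 2) (u : testSpace) :
    ‖toL2 (mulL (χ * η) (mom j u))‖ ^ 2 ≤
      ‖inner ℂ (toL2 (multiplier j (b j) u)) (toL2 (shifted z u))‖ +
      3 * c / L * (‖toL2 (mulL η (mom 0 u))‖ ^ 2 + ‖toL2 (mulL η (mom 1 u))‖ ^ 2) +
      3 * c * ‖toL2 u‖ * (‖toL2 (mulL η (mom 0 u))‖ + ‖toL2 (mulL η (mom 1 u))‖) +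
      2 * c * ‖toL2 u‖ ^ 2 := by
  have hc := W.one_le
  have hcL : 0 ≤ c / L := by positivity
  set q : Fin 2 → ℝ := fun k => ‖toL2 (mulL η (mom k u))‖ with hq
  have hq0 : ∀ k, 0 ≤ q k := fun k => norm_nonneg _
  have hqj : ∀ k, q k ≤ q 0 + q 1 := by
    intro k; fin_cases k
    · simpa using hq0 1
    · simpa using hq0 0
  have hqj2 : ∀ k, q k ^ 2 ≤ q 0 ^ 2 + q 1 ^ 2 := by
    intro k; fin_cases k
    · simpa using sq_nonneg (q 1)
    · simpa using sq_nonneg (q 0)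
  set U := ‖toL2 u‖ with hU
  have hU0 : 0 ≤ U := norm_nonneg _
  have term : ∀ k, (if k = j then ‖toL2 (mulL (χ * η) (mom j u))‖ ^ 2 else 0) -
      c / L * (q 0 ^ 2 + q 1 ^ 2) - 3 / 2 * (c * U * q k) ≤
      (inner ℂ (toL2 (mulL (pd k (b j)) (mom j u))) (toL2 (mom k u))).re -
        1 / 2 * (inner ℂ (toL2 (mulL (pd k (pd j (b j))) u)) (toL2 (mom k u))).im -
        magn k j * (inner ℂ (toL2 (mulL (b j) u)) (toL2 (mom k u))).re := by
    intro k
    have h3 := (Complex.abs_im_le_norm _).trans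
      (norm_inner_mulL_le (W.abs_pd_pd j k) u (mom k u))
    have h4 : |magn k j * (inner ℂ (toL2 (mulL (b j) u)) (toL2 (mom k u))).re| ≤ c * U * q k := by
      rw [abs_mul]
      refine (mul_le_of_le_one_left (abs_nonneg _) (abs_magn_le k j)).trans ?_
      exact (Complex.abs_re_le_norm _).trans (norm_inner_mulL_le (W.abs_b j) u (mom k u))
    have h5 : (if k = j then ‖toL2 (mulL (χ * η) (mom j u))‖ ^ 2 else 0) -
        c / L * (q 0 ^ 2 + q 1 ^ 2) ≤
        (inner ℂ (toL2 (mulL (pd k (b j)) (mom j u))) (toL2 (mom k u))).re := by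
      by_cases hkj : k = j
      · subst hkj
        rw [if_pos rfl, inner_mulL_eq_quad, Complex.ofReal_re]
        have h6 := quad_mono (W.le_pd_b k) (mom k u)
        rw [quad_add, quad_smul, quad_mul_self, quad_mul_self] at h6
        have h7 := mul_le_mul_of_nonneg_left (hqj2 k) hcL
        linarith
      · rw [if_neg hkj]
        have h6 := (Complex.abs_re_le_norm _).trans
          (norm_inner_mulL_le_sq (W.abs_pd_cross j k hkj) (mom j u) (mom k u))
        have h8 : q j ^ 2 + q k ^ 2 ≤ 2 * (q 0 ^ 2 + q 1 ^ 2) := by linarith [hqj2 j, hqj2 k]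
        have h7 := mul_le_mul_of_nonneg_left h8 (show 0 ≤ c / L / 2 by positivity)
        have := (abs_le.1 h6).1
        linarith
    have h3' := (abs_le.1 h3).2
    have h4' := (abs_le.1 h4).2
    linarith
  have hv := virial j (b j) z u
  have hsum := Finset.sum_le_sum (s := Finset.univ) fun k _ => term k
  rw [Finset.sum_sub_distrib, Finset.sum_sub_distrib, Finset.sum_ite_eq' Finset.univ j,
    if_pos (Finset.mem_univ j)] at hsum
  rw [Fin.sum_univ_two (f := fun _ => c / L * (q 0 ^ 2 + q 1 ^ 2)),
    Fin.sum_univ_two (f := fun k => 3 / 2 * (c * U * q k))] at hsum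
  have hb1 : ∀ p, |(pd j coordX * b j).1 p| ≤ c := by
    intro p
    simp only [MulMemClass.coe_mul, Pi.mul_apply, abs_mul, pd_coordX]
    have h1 : |(dir j).1| ≤ 1 := by fin_cases j <;> simp [dir]
    have h2 : |(b j).1 p| ≤ c :=
      (W.abs_b j p).trans (mul_le_of_le_one_right (by linarith) (W.abs_η p))
    exact (mul_le_of_le_one_left (abs_nonneg _) h1).trans h2
  have hx := (abs_le.1 (abs_quad_le hb1 u)).2
  have hA : |(inner ℂ (toL2 (multiplier j (b j) u)) (toL2 u)).re| ≤ (c * (q 0 + q 1) + c * U) * U := by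
    refine (Complex.abs_re_le_norm _).trans ((norm_inner_le_norm _ _).trans ?_)
    refine mul_le_mul_of_nonneg_right ((W.norm_multiplier_le j u).trans ?_) hU0
    have := mul_le_mul_of_nonneg_left (hqj j) (show 0 ≤ c by linarith)
    linarith
  have hA' : z.im * (inner ℂ (toL2 (multiplier j (b j) u)) (toL2 u)).re ≤
      (c * (q 0 + q 1) + c * U) * U := by
    refine (le_abs_self _).trans ?_
    rw [abs_mul, abs_of_pos hz]
    exact (mul_le_of_le_one_left (abs_nonneg _) hz1).trans hA
  have him := (abs_le.1 ((Complex.abs_im_le_norm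
    (inner ℂ (toL2 (multiplier j (b j) u)) (toL2 (shifted z u)))))).2
  have e : 3 * c / L * (q 0 ^ 2 + q 1 ^ 2) = 3 * (c / L * (q 0 ^ 2 + q 1 ^ 2)) := by ring
  have h9 : 0 ≤ c / L * (q 0 ^ 2 + q 1 ^ 2) := by positivity
  change _ ≤ _ + 3 * c / L * (q 0 ^ 2 + q 1 ^ 2) + 3 * c * U * (q 0 + q 1) + 2 * c * U ^ 2
  rw [e]
  have h10 : 0 ≤ c * U * (q 0 + q 1) :=
    mul_nonneg (mul_nonneg (by linarith) hU0) (by linarith [hq0 0, hq0 1])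
  have h11 : 0 ≤ c * U ^ 2 := by positivity
  nlinarith

theorem norm_inner_split_le (φ ψ g h : testSpace) (χ : smoothFn) (hψ : ψ = mulL χ g + h) :
    ‖inner ℂ (toL2 φ) (toL2 ψ)‖ ≤
      ‖toL2 (mulL χ φ)‖ * ‖toL2 g‖ + ‖toL2 φ‖ * ‖toL2 h‖ := by
  rw [hψ, map_add, inner_add_right, ← inner_mulL]
  exact (norm_add_le _ _).trans (add_le_add (norm_inner_le_norm _ _) (norm_inner_le_norm _ _))

/-- Resolution of the system of inequalities between the norms in the virial argument. -/
theorem resolve_inequalities {a U q₀ q₁ b₀ b₁ G h ν L c : ℝ} (ha : 0 ≤ a)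
    (hq₀ : 0 ≤ q₀) (hq₁ : 0 ≤ q₁) (hG : 0 ≤ G) (hh : 0 ≤ h) (hν : 0 < ν) (hν1 : ν ≤ 1)
    (hL : 1 ≤ L) (hc : 1 ≤ c) (hhG : h ≤ ν / √L * G)
    (i0 : ν * U ≤ G + h) (i1 : ν * U ^ 2 ≤ a * G + U * h)
    (i2 : q₀ ^ 2 + q₁ ^ 2 ≤ a * G + U * h + 2 * L * U ^ 2 + c * U * (q₀ + q₁))
    (i3 : b₀ ^ 2 ≤ (c * b₀ + c * a) * G + (c * q₀ + c * U) * h + 3 * c / L * (q₀ ^ 2 + q₁ ^ 2) +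
      3 * c * U * (q₀ + q₁) + 2 * c * U ^ 2)
    (i3' : b₁ ^ 2 ≤ (c * b₁ + c * a) * G + (c * q₁ + c * U) * h + 3 * c / L * (q₀ ^ 2 + q₁ ^ 2) +
      3 * c * U * (q₀ + q₁) + 2 * c * U ^ 2)
    (i4 : L * a ^ 2 ≤ b₀ ^ 2 + b₁ ^ 2 + c * U * (q₀ + q₁) + 2 * c * U ^ 2 + (a * G + U * h)) :
    √L * a ≤ 1000 * c ^ 3 * (G / ν) := by
  obtain ⟨S, hS, hSL⟩ : ∃ S : ℝ, √L = S ∧ L = S ^ 2 :=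
    ⟨√L, rfl, (Real.sq_sqrt (by linarith)).symm⟩
  have hS1 : 1 ≤ S := by rw [← hS]; exact Real.one_le_sqrt.2 hL
  have hS0 : 0 < S := by linarith
  rw [hS] at hhG ⊢
  subst hSL
  obtain ⟨Y, hY⟩ : ∃ Y, Y = G / ν := ⟨_, rfl⟩
  have hGY : G = ν * Y := by rw [hY]; field_simp
  have hY0 : 0 ≤ Y := by rw [hY]; positivity
  rw [← hY]
  have hGleY : G ≤ Y := by rw [hGY]; exact mul_le_of_le_one_left hY0 hν1
  have hhS : S * h ≤ ν * G := by
    have := mul_le_mul_of_nonneg_left hhG hS0.le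
    calc S * h ≤ S * (ν / S * G) := this
      _ = ν * G := by field_simp
  have hhG' : h ≤ G := by
    have h1 : h ≤ S * h := le_mul_of_one_le_left hh hS1
    have h2 : ν * G ≤ G := mul_le_of_le_one_left hG hν1
    linarith
  have hU2 : U ≤ 2 * Y := by
    have : ν * U ≤ ν * (2 * Y) := by linarith
    exact le_of_mul_le_mul_left this hν
  -- the effective size of the solution
  obtain ⟨t, ht⟩ : ∃ t, t = a + 2 * G / S := ⟨_, rfl⟩
  have hSt : S * t = S * a + 2 * G := by rw [ht]; field_simp
  have ht0 : 0 ≤ t := by rw [ht]; positivity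
  have hat : a ≤ t := by rw [ht]; exact le_add_of_nonneg_right (by positivity)
  have hUh : a * G + U * h ≤ t * G := by
    have h1 : S * (U * h) ≤ S * (2 * G / S * G) := by
      have e : S * (2 * G / S * G) = 2 * G * G := by field_simp
      rw [e]
      calc S * (U * h) = U * (S * h) := by ring
        _ ≤ 2 * Y * (ν * G) := mul_le_mul hU2 hhS (by positivity) (by positivity)
        _ = 2 * G * G := by rw [hGY]; ring
    have h2 := le_of_mul_le_mul_left h1 hS0
    rw [ht]; linarith
  obtain ⟨w, hw⟩ : ∃ w, w = t * Y := ⟨_, rfl⟩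
  have hw0 : 0 ≤ w := by rw [hw]; positivity
  have htG : t * G ≤ w := by rw [hw]; exact mul_le_mul_of_nonneg_left hGleY ht0
  have hUw : U ^ 2 ≤ w := by
    have : ν * U ^ 2 ≤ ν * w := by
      calc ν * U ^ 2 ≤ t * G := i1.trans hUh
        _ = ν * w := by rw [hw, hGY]; ring
    exact le_of_mul_le_mul_left this hν
  have haG : a * G ≤ w := (mul_le_mul_of_nonneg_right hat hG).trans htG
  have hhw : h ^ 2 ≤ w := by
    have h1 : S * h ^ 2 ≤ S * w := by
      have h2 : S * h ^ 2 ≤ G * Y := by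
        calc S * h ^ 2 = (S * h) * h := by ring
          _ ≤ (ν * G) * G := mul_le_mul hhS hhG' hh (by positivity)
          _ = G * (ν * G) := by ring
          _ ≤ G * Y := mul_le_mul_of_nonneg_left
              ((mul_le_of_le_one_left hG hν1).trans hGleY) hG
      have h3 : S * w = (S * a + 2 * G) * Y := by rw [hw, ← mul_assoc, hSt]
      rw [h3]
      refine h2.trans (mul_le_mul_of_nonneg_right ?_ hY0)
      linarith [mul_nonneg hS0.le ha]
    exact le_of_mul_le_mul_left h1 hS0
  obtain ⟨r, hr0, hr⟩ : ∃ r, 0 ≤ r ∧ r ^ 2 = w := ⟨√w, Real.sqrt_nonneg _, Real.sq_sqrt hw0⟩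
  have hUr : U ≤ r := abs_le_of_sq_le_sq' (by rw [hr]; exact hUw) hr0 |>.2
  have hhr : h ≤ r := abs_le_of_sq_le_sq' (by rw [hr]; exact hhw) hr0 |>.2
  obtain ⟨q, hq⟩ : ∃ q, q = q₀ + q₁ := ⟨_, rfl⟩
  rw [← hq] at i2 i3 i3' i4
  have hq0 : 0 ≤ q := by rw [hq]; positivity
  have hS2 : 1 ≤ S ^ 2 := one_le_pow₀ hS1
  have hc2 : 1 ≤ c ^ 2 := one_le_pow₀ hc
  have hwS : w ≤ S ^ 2 * w := le_mul_of_one_le_left hw0 hS2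
  have hqq : q ^ 2 ≤ 16 * (c ^ 2 * (S ^ 2 * w)) := by
    have h1 : q ^ 2 ≤ 2 * (q₀ ^ 2 + q₁ ^ 2) := by rw [hq]; linarith [sq_nonneg (q₀ - q₁)]
    have h2 : 2 * (c * U * q) ≤ q ^ 2 / 2 + 2 * (c ^ 2 * U ^ 2) := by
      linarith [sq_nonneg (q - 2 * (c * U))]
    have h3 : c ^ 2 * U ^ 2 ≤ c ^ 2 * (S ^ 2 * w) :=
      mul_le_mul_of_nonneg_left (hUw.trans hwS) (by positivity)
    have h4 : S ^ 2 * U ^ 2 ≤ S ^ 2 * w := mul_le_mul_of_nonneg_left hUw (by positivity)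
    have h5 : S ^ 2 * w ≤ c ^ 2 * (S ^ 2 * w) := le_mul_of_one_le_left (by positivity) hc2
    linarith
  have hqr : q ≤ 4 * (c * S * r) := by
    refine abs_le_of_sq_le_sq' ?_ (by positivity) |>.2
    calc q ^ 2 ≤ _ := hqq
      _ = _ := by rw [← hr]; ring
  have hsq : q₀ ^ 2 + q₁ ^ 2 ≤ q ^ 2 := by rw [hq]; linarith [mul_nonneg hq₀ hq₁]
  have hUq : U * q ≤ 4 * (c * (S * w)) := by
    calc U * q ≤ r * (4 * (c * S * r)) := mul_le_mul hUr hqr hq0 hr0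
      _ = 4 * (c * (S * r ^ 2)) := by ring
      _ = _ := by rw [hr]
  have hSw : w ≤ S * w := le_mul_of_one_le_left hw0 hS1
  have hSw0 : 0 ≤ S * w := by positivity
  have k2 : c * (S * w) ≤ c ^ 3 * (S * w) :=
    mul_le_mul_of_nonneg_right (le_self_pow₀ hc (by norm_num)) hSw0
  have k3 : c ^ 2 * (S * w) ≤ c ^ 3 * (S * w) :=
    mul_le_mul_of_nonneg_right (pow_le_pow_right₀ hc (by norm_num)) hSw0
  have k1 : S * w ≤ c ^ 3 * (S * w) := le_mul_of_one_le_left hSw0 (one_le_pow₀ hc)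
  have m1 : c * (a * G) ≤ c ^ 3 * (S * w) :=
    (mul_le_mul_of_nonneg_left (haG.trans hSw) (by linarith)).trans k2
  have m2 : c * U ^ 2 ≤ c ^ 3 * (S * w) :=
    (mul_le_mul_of_nonneg_left (hUw.trans hSw) (by linarith)).trans k2
  have m3 : c * U * q ≤ 4 * (c ^ 3 * (S * w)) := by
    have := mul_le_mul_of_nonneg_left hUq (show 0 ≤ c by linarith)
    linarith
  have m4 : 3 * c / S ^ 2 * (q₀ ^ 2 + q₁ ^ 2) ≤ 48 * (c ^ 3 * (S * w)) := by
    calc 3 * c / S ^ 2 * (q₀ ^ 2 + q₁ ^ 2) ≤ 3 * c / S ^ 2 * (16 * (c ^ 2 * (S ^ 2 * w))) :=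
          mul_le_mul_of_nonneg_left (hsq.trans hqq) (by positivity)
      _ = 48 * (c ^ 3 * w) := by field_simp; ring
      _ ≤ _ := by
          have := mul_le_mul_of_nonneg_left hSw (show 0 ≤ c ^ 3 by positivity)
          linarith
  have m5 : ∀ x, 0 ≤ x → x ≤ q → (c * x + c * U) * h ≤ 5 * (c ^ 3 * (S * w)) := by
    intro x hx hxq
    have h1 : x * h ≤ 4 * (c * (S * w)) := by
      calc x * h ≤ (4 * (c * S * r)) * r := mul_le_mul (hxq.trans hqr) hhr hh (by positivity)
        _ = 4 * (c * (S * r ^ 2)) := by ring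
        _ = _ := by rw [hr]
    have h2 : U * h ≤ S * w := by
      calc U * h ≤ r * r := mul_le_mul hUr hhr hh hr0
        _ = w := by rw [← hr]; ring
        _ ≤ _ := hSw
    have h3 := mul_le_mul_of_nonneg_left h1 (show 0 ≤ c by linarith)
    have h4 := mul_le_mul_of_nonneg_left h2 (show 0 ≤ c by linarith)
    linarith
  have quadr : ∀ β, β ^ 2 ≤ c * β * G + 70 * (c ^ 3 * (S * w)) →
      β ^ 2 ≤ c ^ 2 * G ^ 2 + 140 * (c ^ 3 * (S * w)) := by
    intro β hβ
    linarith [sq_nonneg (β - c * G)]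
  have j0 := quadr b₀ (by
    have := m5 q₀ hq₀ (by rw [hq]; linarith)
    linarith)
  have j1 := quadr b₁ (by
    have := m5 q₁ hq₁ (by rw [hq]; linarith)
    linarith)
  have hSa : S ^ 2 * a ^ 2 ≤ 2 * (c ^ 2 * G ^ 2) + 290 * (c ^ 3 * (S * w)) := by
    have : a * G + U * h ≤ c ^ 3 * (S * w) := by linarith
    linarith
  obtain ⟨X, hX⟩ : ∃ X, X = S * t := ⟨_, rfl⟩
  have hXY : S * w = X * Y := by rw [hw, hX]; ring
  have hX0 : 0 ≤ X := by rw [hX]; positivity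
  have hcc : c ^ 2 ≤ c ^ 3 := pow_le_pow_right₀ hc (by norm_num)
  have hXX : X ^ 2 ≤ 12 * (c ^ 3 * Y ^ 2) + 580 * (c ^ 3 * (X * Y)) := by
    have h1 : X ^ 2 ≤ 2 * (S ^ 2 * a ^ 2) + 8 * G ^ 2 := by
      rw [hX, hSt]; linarith [sq_nonneg (S * a - 2 * G)]
    have h2 : G ^ 2 ≤ Y ^ 2 := pow_le_pow_left₀ hG hGleY 2
    have h3 : c ^ 2 * G ^ 2 ≤ c ^ 3 * Y ^ 2 := mul_le_mul hcc h2 (by positivity) (by positivity)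
    have h4 : G ^ 2 ≤ c ^ 3 * Y ^ 2 :=
      h2.trans (le_mul_of_one_le_left (by positivity) (one_le_pow₀ hc))
    rw [hXY] at hSa
    linarith
  have hfin : X ≤ 1000 * c ^ 3 * Y := by
    by_contra hcon
    push Not at hcon
    have hc3 : 1 ≤ c ^ 3 := one_le_pow₀ hc
    have hYX : Y ≤ X := by
      have : Y ≤ 1000 * c ^ 3 * Y := le_mul_of_one_le_left hY0 (by linarith)
      linarith
    have hXpos : 0 < X := lt_of_le_of_lt (by positivity) hcon
    have h1 : 1000 * c ^ 3 * Y * X < X * X := mul_lt_mul_of_pos_right hcon hXpos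
    have h2 : c ^ 3 * Y ^ 2 ≤ c ^ 3 * (X * Y) :=
      mul_le_mul_of_nonneg_left
        (by rw [pow_two]; exact mul_le_mul_of_nonneg_right hYX hY0) (by positivity)
    have h3 : 0 ≤ c ^ 3 * (X * Y) := by positivity
    linarith
  calc S * a ≤ S * t := mul_le_mul_of_nonneg_left hat hS0.le
    _ = X := hX.symm
    _ ≤ _ := hfin

theorem Admissible.norm_mulL_le_of_shifted_eq (W : Admissible L c χ η b) (hL : 1 ≤ L) {z : ℂ}
    (hzL : |z.re| = L) (hz : 0 < z.im) (hz1 : z.im ≤ 1) (u g h : testSpace)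
    (hf : shifted z u = mulL χ g + h) (hh : ‖toL2 h‖ ≤ z.im / √L * ‖toL2 g‖) :
    √L * ‖toL2 (mulL χ u)‖ ≤ 1000 * c ^ 3 * (‖toL2 g‖ / z.im) := by
  have hc := W.one_le
  have hc0 : 0 < c := by linarith
  have hη2 : ∀ p, |(η * η).1 p| ≤ 1 := fun p => by
    simp only [MulMemClass.coe_mul, Pi.mul_apply, abs_mul]
    exact mul_le_one₀ (W.abs_η p) (abs_nonneg _) (W.abs_η p)
  have hq1 : ∀ p, |(χ * η * (χ * η)).1 p| ≤ 1 := fun p => by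
    simp only [MulMemClass.coe_mul, Pi.mul_apply, abs_mul]
    have := mul_le_one₀ (W.abs_χ p) (abs_nonneg _) (W.abs_η p)
    exact mul_le_one₀ this (by positivity) this
  have weighted : ∀ e : smoothFn, (∀ p, |e.1 p| ≤ 1) →
      ‖inner ℂ (toL2 (mulL e u)) (toL2 (shifted z u))‖ ≤
        ‖toL2 (mulL χ u)‖ * ‖toL2 g‖ + ‖toL2 u‖ * ‖toL2 h‖ := by
    intro e he
    refine (norm_inner_split_le _ _ g h χ hf).trans ?_
    rw [mulL_mulL, mul_comm χ e, ← mulL_mulL]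
    have h1 := norm_mulL_le he (mulL χ u)
    have h2 := norm_mulL_le he u
    rw [one_mul] at h1 h2
    gcongr
  refine resolve_inequalities (q₀ := ‖toL2 (mulL η (mom 0 u))‖)
    (q₁ := ‖toL2 (mulL η (mom 1 u))‖) (b₀ := ‖toL2 (mulL (χ * η) (mom 0 u))‖)
    (b₁ := ‖toL2 (mulL (χ * η) (mom 1 u))‖) (U := ‖toL2 u‖) (h := ‖toL2 h‖)
    (norm_nonneg _) (norm_nonneg _) (norm_nonneg _) (norm_nonneg _)
    (norm_nonneg _) hz hz1 hL hc hh ?_ ?_ ?_ ?_ ?_ ?_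
  · have h1 : z.im * ‖toL2 u‖ ^ 2 ≤ ‖toL2 u‖ * ‖toL2 (shifted z u)‖ := by
      rw [inner_shifted_self]
      exact (neg_le_abs _).trans ((Complex.abs_im_le_norm _).trans (norm_inner_le_norm _ _))
    have h2 : ‖toL2 (shifted z u)‖ ≤ ‖toL2 g‖ + ‖toL2 h‖ := by
      rw [hf, map_add]
      refine (norm_add_le _ _).trans (add_le_add ?_ le_rfl)
      simpa using norm_mulL_le W.abs_χ g
    by_cases hu : ‖toL2 u‖ = 0
    · rw [hu]; simpa using add_nonneg (norm_nonneg (toL2 g)) (norm_nonneg (toL2 h))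
    · have hu' : 0 < ‖toL2 u‖ := lt_of_le_of_ne (norm_nonneg _) (Ne.symm hu)
      refine le_trans (le_of_mul_le_mul_left ?_ hu') h2
      calc _ = z.im * ‖toL2 u‖ ^ 2 := by ring
        _ ≤ _ := h1
  · rw [inner_shifted_self]
    refine (neg_le_abs _).trans ((Complex.abs_im_le_norm _).trans ?_)
    exact norm_inner_split_le _ _ g h χ hf
  · have h1 := local_energy (η * η) z u
    rw [quad_mul_self η (mom 0 u), quad_mul_self η (mom 1 u)] at h1
    have h2 := (Complex.re_le_norm _).trans (weighted _ hη2)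
    have h3 : z.re * quad (η * η) u ≤ L * ‖toL2 u‖ ^ 2 := by
      refine (le_abs_self _).trans ?_
      rw [abs_mul, hzL]
      have := abs_quad_le hη2 u
      rw [one_mul] at this
      exact mul_le_mul_of_nonneg_left this (by linarith)
    have h4 := (abs_le.1 (abs_quad_le W.abs_x_sq u)).1
    have h5 := fun k => (Complex.im_le_norm _).trans
      (norm_inner_mulL_le (W.abs_pd_sq k) u (mom k u))
    have h50 := h5 0
    have h51 := h5 1
    linarith
  · have h1 := W.virial_le hL hz hz1 0 u
    have h2 := norm_inner_split_le (multiplier 0 (b 0) u) _ g h χ hf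
    have h3 := mul_le_mul_of_nonneg_right (W.norm_mulL_multiplier_le 0 u) (norm_nonneg (toL2 g))
    have h4 := mul_le_mul_of_nonneg_right (W.norm_multiplier_le 0 u) (norm_nonneg (toL2 h))
    linarith
  · have h1 := W.virial_le hL hz hz1 1 u
    have h2 := norm_inner_split_le (multiplier 1 (b 1) u) _ g h χ hf
    have h3 := mul_le_mul_of_nonneg_right (W.norm_mulL_multiplier_le 1 u) (norm_nonneg (toL2 g))
    have h4 := mul_le_mul_of_nonneg_right (W.norm_multiplier_le 1 u) (norm_nonneg (toL2 h))
    linarith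
  · have h1 := local_energy (χ * η * (χ * η)) z u
    rw [quad_mul_self (χ * η) (mom 0 u), quad_mul_self (χ * η) (mom 1 u)] at h1
    have h2 := (Complex.abs_re_le_norm _).trans (weighted _ hq1)
    have h4 := abs_quad_le W.abs_x_q u
    have h5 := fun k => (Complex.abs_im_le_norm _).trans
      (norm_inner_mulL_le (W.abs_pd_q k) u (mom k u))
    have h50 := h5 0
    have h51 := h5 1
    have h6 : L * quad (χ * η * (χ * η)) u ≤ |z.re * quad (χ * η * (χ * η)) u| := by
      rw [abs_mul, hzL]
      exact mul_le_mul_of_nonneg_left (le_abs_self _) (by linarith)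
    have h7 := quad_mono W.χ_le u
    rw [quad_add, quad_smul, quad_one, quad_mul_self χ u] at h7
    have h8 := mul_le_mul_of_nonneg_left h7 (show 0 ≤ L by linarith)
    have h9 : L * (quad (χ * η * (χ * η)) u + c / L * ‖toL2 u‖ ^ 2) =
        L * quad (χ * η * (χ * η)) u + c * ‖toL2 u‖ ^ 2 := by
      field_simp
    rw [h9] at h8
    refine h8.trans ?_
    have h10 : |z.re * quad (χ * η * (χ * η)) u| ≤
        ‖toL2 (mulL (χ * η) (mom 0 u))‖ ^ 2 + ‖toL2 (mulL (χ * η) (mom 1 u))‖ ^ 2 +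
        (‖toL2 (mulL χ u)‖ * ‖toL2 g‖ + ‖toL2 u‖ * ‖toL2 h‖) + c * ‖toL2 u‖ ^ 2 +
        c * ‖toL2 u‖ * ‖toL2 (mulL η (mom 0 u))‖ + c * ‖toL2 u‖ * ‖toL2 (mulL η (mom 1 u))‖ := by
      rw [abs_le] at h2 h4 h50 h51 ⊢
      have n0 := sq_nonneg ‖toL2 (mulL (χ * η) (mom 0 u))‖
      have n1 := sq_nonneg ‖toL2 (mulL (χ * η) (mom 1 u))‖
      constructor <;> linarith [h2.1, h2.2, h4.1, h4.2, h50.1, h50.2, h51.1, h51.2]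
    linarith

end

/-! ### Construction of the weights -/

theorem contDiff_deriv_infty {F : ℝ → ℝ} (hF : ContDiff ℝ ∞ F) : ContDiff ℝ ∞ (deriv F) :=
  (contDiff_infty_iff_deriv.1 hF).2

/-- A function of `x` alone. -/
def liftX (F : ℝ → ℝ) (hF : ContDiff ℝ ∞ F) : smoothFn :=
  ⟨fun p => F p.1, mem_smoothFn.2 (hF.comp contDiff_fst)⟩

/-- A function of `y` alone. -/
def liftY (F : ℝ → ℝ) (hF : ContDiff ℝ ∞ F) : smoothFn :=
  ⟨fun p => F p.2, mem_smoothFn.2 (hF.comp contDiff_snd)⟩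

theorem pd_liftX (k : Fin 2) (F : ℝ → ℝ) (hF : ContDiff ℝ ∞ F) :
    pd k (liftX F hF) = (dir k).1 • liftX (deriv F) (contDiff_deriv_infty hF) := by
  refine Subtype.ext (funext fun p => ?_)
  have h : HasFDerivAt (fun q : ℝ × ℝ => F q.1) _ p :=
    ((hF.differentiable (by simp) p.1).hasDerivAt).comp_hasFDerivAt p
      (ContinuousLinearMap.fst ℝ ℝ ℝ).hasFDerivAt
  change fderiv ℝ (fun q : ℝ × ℝ => F q.1) p (dir k) = (dir k).1 * deriv F p.1
  rw [h.fderiv]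
  simp [mul_comm]

theorem pd_liftY (k : Fin 2) (F : ℝ → ℝ) (hF : ContDiff ℝ ∞ F) :
    pd k (liftY F hF) = (dir k).2 • liftY (deriv F) (contDiff_deriv_infty hF) := by
  refine Subtype.ext (funext fun p => ?_)
  have h : HasFDerivAt (fun q : ℝ × ℝ => F q.2) _ p :=
    ((hF.differentiable (by simp) p.2).hasDerivAt).comp_hasFDerivAt p
      (ContinuousLinearMap.snd ℝ ℝ ℝ).hasFDerivAt
  change fderiv ℝ (fun q : ℝ × ℝ => F q.2) p (dir k) = (dir k).2 * deriv F p.2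
  rw [h.fderiv]
  simp [mul_comm]

theorem pd_smul (k : Fin 2) (c : ℝ) (a : smoothFn) : pd k (c • a) = c • pd k a := by
  refine Subtype.ext (funext fun p => ?_)
  change fderiv ℝ (c • a.1) p (dir k) = c * fderiv ℝ a.1 p (dir k)
  rw [fderiv_const_smul ((contDiff_smoothFn a).differentiable (by simp) p)]
  simp

theorem pd_add (k : Fin 2) (a b : smoothFn) : pd k (a + b) = pd k a + pd k b := by
  refine Subtype.ext (funext fun p => ?_)
  change fderiv ℝ (a.1 + b.1) p (dir k) = fderiv ℝ a.1 p (dir k) + fderiv ℝ b.1 p (dir k)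
  rw [fderiv_add ((contDiff_smoothFn a).differentiable (by simp) p)
    ((contDiff_smoothFn b).differentiable (by simp) p)]
  simp

/-- The energy cutoff `(1 + x² / L²)⁻¹` on the line. -/
def cutoff (L x : ℝ) : ℝ := (1 + x ^ 2 / L ^ 2)⁻¹

theorem contDiff_cutoff (L : ℝ) : ContDiff ℝ ∞ (cutoff L) := by
  unfold cutoff
  refine ContDiff.inv (by fun_prop) fun x => ?_
  positivity

theorem deriv_cutoff (L : ℝ) :
    deriv (cutoff L) = fun x => -(2 * x / L ^ 2) * cutoff L x ^ 2 := by
  funext x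
  have h : HasDerivAt (fun x : ℝ => 1 + x ^ 2 / L ^ 2) (2 * x / L ^ 2) x := by
    simpa using ((hasDerivAt_pow 2 x).div_const (L ^ 2)).const_add 1
  have h' := h.inv (by positivity)
  have h2 : deriv (cutoff L) x = _ := h'.deriv
  rw [h2, cutoff]
  field_simp

theorem deriv_deriv_cutoff (L : ℝ) :
    deriv (deriv (cutoff L)) = fun x =>
      -(2 / L ^ 2) * cutoff L x ^ 2 + 8 * x ^ 2 / L ^ 4 * cutoff L x ^ 3 := by
  funext x
  have hd : HasDerivAt (cutoff L) (-(2 * x / L ^ 2) * cutoff L x ^ 2) x := by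
    have := ((contDiff_cutoff L).differentiable (by simp) x).hasDerivAt
    rwa [deriv_cutoff] at this
  have h1 : HasDerivAt (fun x : ℝ => -(2 * x / L ^ 2)) (-(2 / L ^ 2)) x := by
    simpa using (((hasDerivAt_id x).const_mul 2).div_const (L ^ 2)).fun_neg
  have h2 : HasDerivAt (fun x => -(2 * x / L ^ 2) * cutoff L x ^ 2) _ x := h1.mul (hd.pow 2)
  rw [deriv_cutoff, h2.deriv]
  simp
  ring

theorem cutoff_pos (L x : ℝ) : 0 < cutoff L x := by unfold cutoff; positivity

theorem cutoff_le_one (L x : ℝ) : cutoff L x ≤ 1 :=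
  inv_le_one_of_one_le₀ (le_add_of_nonneg_right (by positivity))

theorem cutoff_mul {L : ℝ} (x : ℝ) : cutoff L x * (1 + x ^ 2 / L ^ 2) = 1 :=
  inv_mul_cancel₀ (by positivity)

theorem abs_mul_cutoff_le {L : ℝ} (hL : 0 < L) (x : ℝ) : 2 * |x| * cutoff L x ≤ L := by
  have h1 : 2 * |x| ≤ L * (1 + x ^ 2 / L ^ 2) := by
    have : L * (1 + x ^ 2 / L ^ 2) - 2 * |x| = (L - |x|) ^ 2 / L := by
      rw [← sq_abs x]; field_simp; ring
    have h2 : 0 ≤ (L - |x|) ^ 2 / L := by positivity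
    linarith
  calc 2 * |x| * cutoff L x ≤ L * (1 + x ^ 2 / L ^ 2) * cutoff L x :=
        mul_le_mul_of_nonneg_right h1 (cutoff_pos L x).le
    _ = L * (cutoff L x * (1 + x ^ 2 / L ^ 2)) := by ring
    _ = L := by rw [cutoff_mul, mul_one]

theorem abs_deriv_cutoff_le {L : ℝ} (hL : 0 < L) (x : ℝ) :
    |deriv (cutoff L) x| ≤ cutoff L x / L := by
  have hN := cutoff_pos L x
  have e : |deriv (cutoff L) x| = (2 * |x| * cutoff L x) * (cutoff L x / L ^ 2) := by
    rw [deriv_cutoff]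
    simp only [abs_mul, abs_neg, abs_div, abs_pow, abs_of_pos hL, abs_of_pos hN, abs_two]
    ring
  rw [e]
  calc _ ≤ L * (cutoff L x / L ^ 2) :=
        mul_le_mul_of_nonneg_right (abs_mul_cutoff_le hL x) (by positivity)
    _ = _ := by field_simp

theorem abs_deriv_deriv_cutoff_le {L : ℝ} (hL : 1 ≤ L) (x : ℝ) :
    |deriv (deriv (cutoff L)) x| ≤ 4 * cutoff L x := by
  have hL0 : 0 < L := by linarith
  have hN := cutoff_pos L x
  have hN1 := cutoff_le_one L x
  have hL2 : 1 ≤ L ^ 2 := one_le_pow₀ hL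
  have h1 : 2 / L ^ 2 * cutoff L x ^ 2 ≤ 2 * cutoff L x := by
    have ha : 2 / L ^ 2 ≤ 2 := div_le_self (by norm_num) hL2
    have hb : cutoff L x ^ 2 ≤ cutoff L x := pow_le_of_le_one hN.le hN1 (by norm_num)
    exact mul_le_mul ha hb (by positivity) (by norm_num)
  have h2 : 8 * x ^ 2 / L ^ 4 * cutoff L x ^ 3 ≤ 2 * cutoff L x := by
    have ha : (2 * |x| * cutoff L x) ^ 2 ≤ L ^ 2 :=
      pow_le_pow_left₀ (by positivity) (abs_mul_cutoff_le hL0 x) 2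
    calc 8 * x ^ 2 / L ^ 4 * cutoff L x ^ 3 =
          (2 * |x| * cutoff L x) ^ 2 * (2 * cutoff L x / L ^ 4) := by
          rw [mul_pow, mul_pow, sq_abs]; ring
      _ ≤ L ^ 2 * (2 * cutoff L x / L ^ 4) := mul_le_mul_of_nonneg_right ha (by positivity)
      _ = 2 * cutoff L x / L ^ 2 := by field_simp
      _ ≤ 2 * cutoff L x := div_le_self (by positivity) hL2
  have h3 : 0 ≤ 2 / L ^ 2 * cutoff L x ^ 2 := by positivity
  have h4 : 0 ≤ 8 * x ^ 2 / L ^ 4 * cutoff L x ^ 3 := by positivity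
  rw [deriv_deriv_cutoff, abs_le]
  constructor <;> simp only <;> linarith

/-- The energy cutoff as a smooth function on the plane. -/
def etaFn (L : ℝ) : smoothFn := liftX (cutoff L) (contDiff_cutoff L)

/-- The weight `⟨r⟩⁻¹` as a smooth function. -/
def chiFn : smoothFn :=
  ⟨fun p => (√(1 + (p.1 ^ 2 + p.2 ^ 2)))⁻¹, mem_smoothFn.2
    (((by fun_prop : ContDiff ℝ ∞ fun p : ℝ × ℝ => 1 + (p.1 ^ 2 + p.2 ^ 2)).sqrt
      (fun p => by positivity)).inv (fun p => by positivity))⟩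

/-- The weight `⟨r⟩⁻²` as a smooth function. -/
def chiSq : smoothFn :=
  ⟨fun p => (1 + (p.1 ^ 2 + p.2 ^ 2))⁻¹, mem_smoothFn.2
    (ContDiff.inv (by fun_prop) (fun p => by positivity))⟩

theorem chiFn_mul_self : chiFn * chiFn = chiSq := by
  refine Subtype.ext (funext fun p => ?_)
  change (√(1 + (p.1 ^ 2 + p.2 ^ 2)))⁻¹ * (√(1 + (p.1 ^ 2 + p.2 ^ 2)))⁻¹ = _
  rw [← mul_inv, Real.mul_self_sqrt (by positivity)]
  rfl

theorem pd_chiSq (k : Fin 2) (p : ℝ × ℝ) :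
    (pd k chiSq).1 p = -(2 * (p.1 * (dir k).1 + p.2 * (dir k).2)) * chiSq.1 p ^ 2 := by
  have h1 : HasFDerivAt (fun q : ℝ × ℝ => 1 + (q.1 ^ 2 + q.2 ^ 2)) _ p :=
    (((ContinuousLinearMap.fst ℝ ℝ ℝ).hasFDerivAt.pow 2).add
      ((ContinuousLinearMap.snd ℝ ℝ ℝ).hasFDerivAt.pow 2)).const_add 1
  have h2 := (hasDerivAt_inv (x := 1 + (p.1 ^ 2 + p.2 ^ 2)) (by positivity)).comp_hasFDerivAt p h1
  have h3 : HasFDerivAt (fun q : ℝ × ℝ => (1 + (q.1 ^ 2 + q.2 ^ 2))⁻¹) _ p := h2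
  change fderiv ℝ (fun q : ℝ × ℝ => (1 + (q.1 ^ 2 + q.2 ^ 2))⁻¹) p (dir k) =
    -(2 * (p.1 * (dir k).1 + p.2 * (dir k).2)) * ((1 + (p.1 ^ 2 + p.2 ^ 2))⁻¹) ^ 2
  rw [h3.fderiv]
  simp
  ring

theorem abs_pd_chiSq_le (k : Fin 2) (p : ℝ × ℝ) : |(pd k chiSq).1 p| ≤ 1 := by
  have h0 : 0 < 1 + (p.1 ^ 2 + p.2 ^ 2) := by positivity
  have h : ∀ t : ℝ, t ^ 2 ≤ p.1 ^ 2 + p.2 ^ 2 →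
      |-(2 * t) * ((1 + (p.1 ^ 2 + p.2 ^ 2))⁻¹) ^ 2| ≤ 1 := by
    intro t ht
    rw [abs_mul, abs_of_nonneg (a := ((1 + (p.1 ^ 2 + p.2 ^ 2))⁻¹) ^ 2) (by positivity), inv_pow,
      ← div_eq_mul_inv, div_le_one (by positivity), abs_neg, abs_le]
    have ha : 1 + t ^ 2 ≤ (1 + (p.1 ^ 2 + p.2 ^ 2)) ^ 2 := by
      nlinarith [sq_nonneg t]
    constructor <;> nlinarith [sq_nonneg (t - 1), sq_nonneg (t + 1)]
  rw [pd_chiSq]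
  fin_cases k
  · simpa [dir, chiSq] using h p.1 (by nlinarith [sq_nonneg p.2])
  · simpa [dir, chiSq] using h p.2 (by nlinarith [sq_nonneg p.1])

theorem deriv_arctan_eq : deriv Real.arctan = fun x => (1 + x ^ 2)⁻¹ := by
  rw [Real.deriv_arctan]; funext x; rw [one_div]

theorem abs_deriv_deriv_arctan_le (x : ℝ) : |deriv (deriv Real.arctan) x| ≤ 1 := by
  have h : HasDerivAt (fun x : ℝ => 1 + x ^ 2) (2 * x) x := by
    simpa using (hasDerivAt_pow 2 x).const_add 1
  have h0 : 0 < 1 + x ^ 2 := by positivity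
  have h' : HasDerivAt (fun x : ℝ => (1 + x ^ 2)⁻¹) _ x := h.inv h0.ne'
  rw [deriv_arctan_eq, h'.deriv, abs_div, abs_of_pos (pow_pos h0 2), div_le_one (by positivity),
    abs_neg, abs_le]
  constructor <;> nlinarith [sq_nonneg (x - 1), sq_nonneg (x + 1), sq_nonneg (x ^ 2)]

theorem abs_arctan_le (x : ℝ) : |Real.arctan x| ≤ 2 := by
  have h1 := Real.arctan_lt_pi_div_two x
  have h2 := Real.neg_pi_div_two_lt_arctan x
  have h3 := Real.pi_le_four
  rw [abs_le]; constructor <;> linarith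

theorem chiSq_pos (p : ℝ × ℝ) : 0 < chiSq.1 p := by
  change 0 < (1 + (p.1 ^ 2 + p.2 ^ 2))⁻¹
  positivity

theorem chiSq_mul (p : ℝ × ℝ) : chiSq.1 p * (1 + (p.1 ^ 2 + p.2 ^ 2)) = 1 :=
  inv_mul_cancel₀ (by positivity)

theorem chiSq_le_one (p : ℝ × ℝ) : chiSq.1 p ≤ 1 :=
  inv_le_one_of_one_le₀ (le_add_of_nonneg_right (by positivity))

theorem chiSq_mul_sq_le (p : ℝ × ℝ) : p.1 ^ 2 * chiSq.1 p ≤ 1 := by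
  nlinarith [chiSq_mul p, chiSq_pos p, mul_nonneg (chiSq_pos p).le (sq_nonneg p.2)]

theorem chiSq_mul_abs_le (p : ℝ × ℝ) : |p.1| * chiSq.1 p ≤ 1 := by
  have h : |p.1| ≤ 1 + (p.1 ^ 2 + p.2 ^ 2) := by
    rw [← sq_abs p.1]; nlinarith [sq_nonneg (|p.1| - 1), sq_nonneg p.2]
  have := mul_le_mul_of_nonneg_left h (chiSq_pos p).le
  rw [chiSq_mul] at this
  linarith

/-- The square of the energy cutoff. -/
def etaSq (L : ℝ) : smoothFn := etaFn L * etaFn L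

theorem etaSq_apply (L : ℝ) (p : ℝ × ℝ) : (etaSq L).1 p = cutoff L p.1 ^ 2 :=
  (pow_two (cutoff L p.1)).symm

/-- The `x`-derivative of the square of the energy cutoff. -/
def etaSqX (L : ℝ) : smoothFn := pd 0 (etaSq L)

theorem etaSqX_apply (L : ℝ) (p : ℝ × ℝ) :
    (etaSqX L).1 p = 2 * cutoff L p.1 * deriv (cutoff L) p.1 := by
  simp only [etaSqX, etaSq, etaFn, pd_mul, pd_liftX]
  simp [dir, liftX]
  ring

theorem pd_etaSq_one (L : ℝ) : pd 1 (etaSq L) = 0 := by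
  simp [etaSq, etaFn, pd_mul, pd_liftX, dir]

theorem abs_etaSqX_le {L : ℝ} (hL : 0 < L) (p : ℝ × ℝ) :
    |(etaSqX L).1 p| ≤ 2 / L * cutoff L p.1 ^ 2 := by
  have hN := cutoff_pos L p.1
  rw [etaSqX_apply, abs_mul, abs_of_pos (by positivity : 0 < 2 * cutoff L p.1)]
  calc _ ≤ 2 * cutoff L p.1 * (cutoff L p.1 / L) :=
        mul_le_mul_of_nonneg_left (abs_deriv_cutoff_le hL p.1) (by positivity)
    _ = _ := by ring

theorem pd_etaSqX_apply (L : ℝ) (p : ℝ × ℝ) :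
    (pd 0 (etaSqX L)).1 p =
      2 * deriv (cutoff L) p.1 ^ 2 + 2 * cutoff L p.1 * deriv (deriv (cutoff L)) p.1 := by
  simp only [etaSqX, etaSq, etaFn, pd_mul, pd_liftX, pd_add, pd_smul]
  simp [dir, liftX]
  ring

theorem pd_etaSqX_one (L : ℝ) : pd 1 (etaSqX L) = 0 := by
  simp [etaSqX, etaSq, etaFn, pd_mul, pd_liftX, pd_add, dir]

theorem abs_pd_etaSqX_le {L : ℝ} (hL : 1 ≤ L) (p : ℝ × ℝ) :
    |(pd 0 (etaSqX L)).1 p| ≤ 10 * cutoff L p.1 ^ 2 := by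
  have hL0 : 0 < L := by linarith
  have hN := cutoff_pos L p.1
  have h1 : |deriv (cutoff L) p.1| ≤ cutoff L p.1 :=
    (abs_deriv_cutoff_le hL0 p.1).trans (div_le_self hN.le hL)
  have h2 : deriv (cutoff L) p.1 ^ 2 ≤ cutoff L p.1 ^ 2 := by
    rw [← sq_abs]; exact pow_le_pow_left₀ (abs_nonneg _) h1 2
  have h3 := abs_le.1 (abs_deriv_deriv_cutoff_le hL p.1)
  have h4 := mul_le_mul_of_nonneg_left h3.1 hN.le
  have h5 := mul_le_mul_of_nonneg_left h3.2 hN.le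
  rw [pd_etaSqX_apply, abs_le]
  constructor <;> nlinarith [sq_nonneg (deriv (cutoff L) p.1)]

/-- `arctan x` as a function on the plane. -/
def arctanX : smoothFn := liftX Real.arctan Real.contDiff_arctan

/-- `arctan y` as a function on the plane. -/
def arctanY : smoothFn := liftY Real.arctan Real.contDiff_arctan

/-- The multiplier functions of the virial argument. -/
def virialFn (L : ℝ) : Fin 2 → smoothFn := ![arctanX * etaSq L, arctanY * etaSq L]

theorem pd_arctanX (p : ℝ × ℝ) : (pd 0 arctanX).1 p = (1 + p.1 ^ 2)⁻¹ := by
  rw [arctanX, pd_liftX]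
  simp [dir, liftX]

theorem pd_arctanX_one : pd 1 arctanX = 0 := by simp [arctanX, pd_liftX, dir]

theorem pd_pd_arctanX (p : ℝ × ℝ) : |(pd 0 (pd 0 arctanX)).1 p| ≤ 1 := by
  rw [arctanX, pd_liftX, pd_smul, pd_liftX]
  simpa [dir, liftX] using abs_deriv_deriv_arctan_le p.1

theorem pd_pd_arctanX_one : pd 1 (pd 0 arctanX) = 0 := by
  simp [arctanX, pd_liftX, dir]

theorem pd_arctanY (p : ℝ × ℝ) : (pd 1 arctanY).1 p = (1 + p.2 ^ 2)⁻¹ := by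
  rw [arctanY, pd_liftY]
  simp [dir, liftY]

theorem pd_arctanY_zero : pd 0 arctanY = 0 := by simp [arctanY, pd_liftY, dir]

theorem pd_pd_arctanY (p : ℝ × ℝ) : |(pd 1 (pd 1 arctanY)).1 p| ≤ 1 := by
  rw [arctanY, pd_liftY, pd_smul, pd_liftY]
  simpa [dir, liftY] using abs_deriv_deriv_arctan_le p.2

theorem pd_pd_arctanY_zero : pd 0 (pd 1 arctanY) = 0 := by
  simp [arctanY, pd_liftY, dir]

theorem coe_mul_apply (a b : smoothFn) (p : ℝ × ℝ) : (a * b).1 p = a.1 p * b.1 p := rfl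

theorem coe_add_apply (a b : smoothFn) (p : ℝ × ℝ) : (a + b).1 p = a.1 p + b.1 p := rfl

theorem coe_smul_apply (c : ℝ) (a : smoothFn) (p : ℝ × ℝ) : (c • a).1 p = c * a.1 p := rfl

theorem coe_zero_apply (p : ℝ × ℝ) : (0 : smoothFn).1 p = 0 := rfl

theorem coe_one_apply (p : ℝ × ℝ) : (1 : smoothFn).1 p = 1 := rfl

theorem pd_virialFn_zero (L : ℝ) :
    pd 0 (virialFn L 0) = pd 0 arctanX * etaSq L + arctanX * etaSqX L := by
  change pd 0 (arctanX * etaSq L) = _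
  rw [pd_mul]; rfl

theorem pd_virialFn_one (L : ℝ) : pd 1 (virialFn L 1) = pd 1 arctanY * etaSq L := by
  change pd 1 (arctanY * etaSq L) = _
  rw [pd_mul, pd_etaSq_one, mul_zero, add_zero]

theorem admissible {L : ℝ} (hL : 1 ≤ L) :
    Admissible L 30 chiFn (etaFn L) (virialFn L) := by
  have hL0 : 0 < L := by linarith
  have hq : chiFn * etaFn L * (chiFn * etaFn L) = chiSq * etaSq L := by
    rw [← chiFn_mul_self, etaSq]; ring
  have hη : ∀ p : ℝ × ℝ, (etaFn L).1 p = cutoff L p.1 := fun p => rfl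
  have hN : ∀ p : ℝ × ℝ, 0 < cutoff L p.1 := fun p => cutoff_pos L p.1
  have hN1 : ∀ p : ℝ × ℝ, cutoff L p.1 ≤ 1 := fun p => cutoff_le_one L p.1
  have hN2 : ∀ p : ℝ × ℝ, cutoff L p.1 ^ 2 ≤ cutoff L p.1 := fun p =>
    pow_le_of_le_one (hN p).le (hN1 p) (by norm_num)
  have hEX : ∀ p, |(etaSqX L).1 p| ≤ 2 * cutoff L p.1 ^ 2 := fun p =>
    (abs_etaSqX_le hL0 p).trans (mul_le_mul_of_nonneg_right
      (div_le_self (by norm_num) hL) (by positivity))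
  have hpdE : ∀ k p, |(pd k (etaSq L)).1 p| ≤ 2 * cutoff L p.1 ^ 2 := by
    intro k p
    fin_cases k
    · exact hEX p
    · change |(pd 1 (etaSq L)).1 p| ≤ _
      rw [pd_etaSq_one, coe_zero_apply, abs_zero]; positivity
  have hAX : ∀ p : ℝ × ℝ, |arctanX.1 p| ≤ 2 := fun p => abs_arctan_le p.1
  have hAY : ∀ p : ℝ × ℝ, |arctanY.1 p| ≤ 2 := fun p => abs_arctan_le p.2
  have inv_le : ∀ t : ℝ, 0 < (1 + t ^ 2)⁻¹ ∧ (1 + t ^ 2)⁻¹ ≤ 1 := fun t =>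
    ⟨by positivity, inv_le_one_of_one_le₀ (le_add_of_nonneg_right (by positivity))⟩
  have hAX' : ∀ p : ℝ × ℝ, |(pd 0 arctanX).1 p| ≤ 1 := fun p => by
    rw [pd_arctanX, abs_of_pos (inv_le _).1]; exact (inv_le _).2
  have hAY' : ∀ p : ℝ × ℝ, |(pd 1 arctanY).1 p| ≤ 1 := fun p => by
    rw [pd_arctanY, abs_of_pos (inv_le _).1]; exact (inv_le _).2
  have prod : ∀ {x y A B : ℝ}, |x| ≤ A → |y| ≤ B → |x * y| ≤ A * B := by
    intro x y A B hx hy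
    rw [abs_mul]
    exact mul_le_mul hx hy (abs_nonneg _) ((abs_nonneg _).trans hx)
  have hE : ∀ p, |(etaSq L).1 p| ≤ cutoff L p.1 ^ 2 := fun p => by
    rw [etaSq_apply, abs_of_nonneg (by positivity)]
  have hχ0 : ∀ p, 0 < chiFn.1 p := fun p => by
    change 0 < (√(1 + (p.1 ^ 2 + p.2 ^ 2)))⁻¹
    positivity
  refine ⟨by norm_num, fun p => ?_, fun p => ?_, fun k p => ?_, fun p => ?_, fun k p => ?_,
    fun p => ?_, fun p => ?_, fun j p => ?_, fun j p => ?_, fun j p => ?_, fun j k hkj p => ?_,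
    fun j k p => ?_⟩
  · rw [abs_of_pos (hχ0 p)]
    refine inv_le_one_of_one_le₀ (Real.one_le_sqrt.2 (le_add_of_nonneg_right (by positivity)))
  · rw [hη, abs_of_pos (hN p)]; exact hN1 p
  · rw [hη, abs_of_pos (hN p)]
    have := hpdE k p
    change |(pd k (etaSq L)).1 p| ≤ _
    linarith [hN2 p, hN p]
  · change |(coordX * etaSq L).1 p| ≤ L
    rw [coe_mul_apply, etaSq_apply, abs_mul, abs_of_nonneg (sq_nonneg (cutoff L p.1))]
    change |p.1| * _ ≤ _
    have h1 := abs_mul_cutoff_le hL0 p.1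
    have h2 := mul_le_mul_of_nonneg_left (hN2 p) (abs_nonneg p.1)
    linarith [mul_nonneg (abs_nonneg p.1) (hN p).le]
  · rw [hq, pd_mul, coe_add_apply, coe_mul_apply, coe_mul_apply, hη, abs_of_pos (hN p)]
    have h1 := prod (abs_pd_chiSq_le k p) (hE p)
    have h2 := prod (show |chiSq.1 p| ≤ 1 by
      rw [abs_of_pos (chiSq_pos p)]; exact chiSq_le_one p) (hpdE k p)
    have h3 := abs_add_le ((pd k chiSq).1 p * (etaSq L).1 p) (chiSq.1 p * (pd k (etaSq L)).1 p)
    linarith [hN2 p, hN p]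
  · rw [hq, coe_mul_apply, coe_mul_apply, etaSq_apply, abs_mul,
      abs_of_nonneg (mul_nonneg (chiSq_pos p).le (sq_nonneg (cutoff L p.1)))]
    change |p.1| * _ ≤ _
    have h1 := chiSq_mul_abs_le p
    have h2 : cutoff L p.1 ^ 2 ≤ 1 := (hN2 p).trans (hN1 p)
    have h3 := mul_le_mul h1 h2 (by positivity) (by norm_num)
    linarith
  · rw [hq, chiFn_mul_self, coe_add_apply, coe_smul_apply, coe_mul_apply, coe_one_apply,
      etaSq_apply, mul_one]
    have h1 := cutoff_mul (L := L) p.1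
    have h2 : 1 - cutoff L p.1 ^ 2 ≤ 2 * (p.1 ^ 2 / L ^ 2) := by
      have h3 : 1 - cutoff L p.1 ≤ p.1 ^ 2 / L ^ 2 := by
        have : 0 ≤ p.1 ^ 2 / L ^ 2 := by positivity
        have := mul_le_mul_of_nonneg_right (hN1 p) this
        linarith
      have h4 : (1 - cutoff L p.1) * (1 + cutoff L p.1) ≤ p.1 ^ 2 / L ^ 2 * 2 :=
        mul_le_mul h3 (by linarith [hN1 p]) (by linarith [hN p]) (by positivity)
      linarith
    have h5 := mul_le_mul_of_nonneg_left h2 (chiSq_pos p).le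
    have h6 : chiSq.1 p * (2 * (p.1 ^ 2 / L ^ 2)) ≤ 2 / L ^ 2 := by
      calc _ = (p.1 ^ 2 * chiSq.1 p) * (2 / L ^ 2) := by ring
        _ ≤ 1 * (2 / L ^ 2) :=
            mul_le_mul_of_nonneg_right (chiSq_mul_sq_le p) (by positivity)
        _ = _ := one_mul _
    have h7 : 2 / L ^ 2 ≤ 30 / L := by
      rw [div_le_div_iff₀ (by positivity) hL0]; nlinarith
    linarith
  · rw [hη, abs_of_pos (hN p)]
    fin_cases j
    · have := prod (hAX p) (hE p)
      change |(arctanX * etaSq L).1 p| ≤ _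
      rw [coe_mul_apply]
      linarith [hN2 p, hN p]
    · have := prod (hAY p) (hE p)
      change |(arctanY * etaSq L).1 p| ≤ _
      rw [coe_mul_apply]
      linarith [hN2 p, hN p]
  · fin_cases j
    · change |(pd 0 (virialFn L 0)).1 p| ≤ _
      rw [pd_virialFn_zero, coe_add_apply, coe_mul_apply, coe_mul_apply]
      have h1 := prod (hAX' p) (hE p)
      have h2 := prod (hAX p) (hEX p)
      have h3 := abs_add_le ((pd 0 arctanX).1 p * (etaSq L).1 p) (arctanX.1 p * (etaSqX L).1 p)
      linarith [hN2 p, hN1 p]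
    · change |(pd 1 (virialFn L 1)).1 p| ≤ _
      rw [pd_virialFn_one, coe_mul_apply]
      have h1 := prod (hAY' p) (hE p)
      linarith [hN2 p, hN1 p]
  · rw [hq, coe_add_apply, coe_smul_apply]
    change (chiSq * etaSq L).1 p ≤ _ + 30 / L * (etaSq L).1 p
    rw [coe_mul_apply, etaSq_apply]
    have h30 : 0 ≤ 30 / L * cutoff L p.1 ^ 2 := by positivity
    fin_cases j
    · change _ ≤ (pd 0 (virialFn L 0)).1 p + _
      rw [pd_virialFn_zero, coe_add_apply, coe_mul_apply, coe_mul_apply, etaSq_apply, pd_arctanX]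
      have h1 : chiSq.1 p ≤ (1 + p.1 ^ 2)⁻¹ :=
        inv_anti₀ (by positivity) (by linarith [sq_nonneg p.2])
      have h2 := mul_le_mul_of_nonneg_right h1 (sq_nonneg (cutoff L p.1))
      have h3 := (abs_le.1 (prod (hAX p) (abs_etaSqX_le hL0 p))).1
      have h4 : 2 * (2 / L * cutoff L p.1 ^ 2) ≤ 30 / L * cutoff L p.1 ^ 2 := by
        have : 0 ≤ cutoff L p.1 ^ 2 / L := by positivity
        calc _ = 4 * (cutoff L p.1 ^ 2 / L) := by ring
          _ ≤ 30 * (cutoff L p.1 ^ 2 / L) := by linarith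
          _ = _ := by ring
      linarith
    · change _ ≤ (pd 1 (virialFn L 1)).1 p + _
      rw [pd_virialFn_one, coe_mul_apply, etaSq_apply, pd_arctanY]
      have h1 : chiSq.1 p ≤ (1 + p.2 ^ 2)⁻¹ :=
        inv_anti₀ (by positivity) (by linarith [sq_nonneg p.1])
      have h2 := mul_le_mul_of_nonneg_right h1 (sq_nonneg (cutoff L p.1))
      linarith
  · change _ ≤ 30 / L * (etaSq L).1 p
    rw [etaSq_apply]
    have h30 : 0 ≤ 30 / L * cutoff L p.1 ^ 2 := by positivity
    have h4 : 2 * (2 / L * cutoff L p.1 ^ 2) ≤ 30 / L * cutoff L p.1 ^ 2 := by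
      have : 0 ≤ cutoff L p.1 ^ 2 / L := by positivity
      calc _ = 4 * (cutoff L p.1 ^ 2 / L) := by ring
        _ ≤ 30 * (cutoff L p.1 ^ 2 / L) := by linarith
        _ = _ := by ring
    fin_cases j <;> fin_cases k
    · exact absurd rfl hkj
    · change |(pd 1 (arctanX * etaSq L)).1 p| ≤ _
      rw [pd_mul, pd_arctanX_one, pd_etaSq_one, zero_mul, mul_zero, add_zero, coe_zero_apply,
        abs_zero]
      exact h30
    · change |(pd 0 (arctanY * etaSq L)).1 p| ≤ _
      rw [pd_mul, pd_arctanY_zero, zero_mul, zero_add, coe_mul_apply]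
      exact (prod (hAY p) (abs_etaSqX_le hL0 p)).trans h4
    · exact absurd rfl hkj
  · rw [hη, abs_of_pos (hN p)]
    fin_cases j <;> fin_cases k
    · change |(pd 0 (pd 0 (virialFn L 0))).1 p| ≤ _
      rw [pd_virialFn_zero, pd_add, pd_mul, pd_mul]
      simp only [coe_add_apply, coe_mul_apply]
      have h1 := prod (pd_pd_arctanX p) (hE p)
      have h2 := prod (hAX' p) (hEX p)
      have h3 := prod (hAX p) (abs_pd_etaSqX_le hL p)
      have h4 := abs_add_le ((pd 0 (pd 0 arctanX)).1 p * (etaSq L).1 p +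
        (pd 0 arctanX).1 p * (pd 0 (etaSq L)).1 p)
        ((pd 0 arctanX).1 p * (etaSqX L).1 p + arctanX.1 p * (pd 0 (etaSqX L)).1 p)
      have h5 := abs_add_le ((pd 0 (pd 0 arctanX)).1 p * (etaSq L).1 p)
        ((pd 0 arctanX).1 p * (pd 0 (etaSq L)).1 p)
      have h6 := abs_add_le ((pd 0 arctanX).1 p * (etaSqX L).1 p)
        (arctanX.1 p * (pd 0 (etaSqX L)).1 p)
      have h7 : |(pd 0 arctanX).1 p * (pd 0 (etaSq L)).1 p| ≤ 1 * (2 * cutoff L p.1 ^ 2) := h2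
      linarith [hN2 p, hN p]
    · change |(pd 1 (pd 0 (virialFn L 0))).1 p| ≤ _
      rw [pd_virialFn_zero, pd_add, pd_mul, pd_mul, pd_pd_arctanX_one, pd_etaSq_one,
        pd_arctanX_one, pd_etaSqX_one]
      simp only [zero_mul, mul_zero, add_zero, coe_zero_apply, abs_zero]
      linarith [hN p]
    · change |(pd 0 (pd 1 (virialFn L 1))).1 p| ≤ _
      rw [pd_virialFn_one, pd_mul, pd_pd_arctanY_zero, zero_mul, zero_add, coe_mul_apply]
      have h2 := prod (hAY' p) (hpdE 0 p)
      linarith [hN2 p, hN p]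
    · change |(pd 1 (pd 1 (virialFn L 1))).1 p| ≤ _
      rw [pd_virialFn_one, pd_mul, pd_etaSq_one, mul_zero, add_zero, coe_mul_apply]
      have h2 := prod (pd_pd_arctanY p) (hE p)
      linarith [hN2 p, hN p]

/-! ### Smooth almost null vectors -/

theorem tsupport_mom_subset (k : Fin 2) (φ : testSpace) :
    tsupport (mom k φ).1 ⊆ tsupport φ.1 := by
  refine closure_minimal (fun p hp => ?_) (isClosed_tsupport _)
  by_contra hcon
  have h1 : φ.1 p = 0 := image_eq_zero_of_notMem_tsupport hcon
  have h2 : fderiv ℝ φ.1 p = 0 :=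
    image_eq_zero_of_notMem_tsupport fun h => hcon (tsupport_fderiv_subset ℝ h)
  apply hp
  rw [mom_apply, h1, h2]
  simp

theorem shifted_apply_eq_zero (z : ℂ) (φ : testSpace) {p : ℝ × ℝ} (hp : p ∉ tsupport φ.1) :
    (shifted z φ).1 p = 0 := by
  have h : ∀ k, (mom k (mom k φ)).1 p = 0 := fun k => image_eq_zero_of_notMem_tsupport
    fun h => hp (tsupport_mom_subset k φ (tsupport_mom_subset k _ h))
  rw [shifted, exprLin_eq, test_sub_apply, test_add_apply, test_add_apply, test_smul_apply,
    mulL_apply, h, h, image_eq_zero_of_notMem_tsupport hp]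
  simp

/-- A fixed bump function on the plane. -/
def bump : ContDiffBump (0 : ℝ × ℝ) := ⟨1, 2, one_pos, one_lt_two⟩

/-- Dilated bump functions. -/
def bumpFn (R : ℝ) : smoothFn :=
  ⟨fun p => bump (R⁻¹ • p), mem_smoothFn.2 (bump.contDiff.comp (contDiff_const_smul R⁻¹))⟩

theorem abs_bumpFn_le (R : ℝ) (p : ℝ × ℝ) : |(bumpFn R).1 p| ≤ 1 := by
  change |bump (R⁻¹ • p)| ≤ 1
  rw [abs_of_nonneg bump.nonneg]
  exact bump.le_one

theorem bumpFn_eq_one {R : ℝ} (hR : 0 < R) {p : ℝ × ℝ} (hp : ‖p‖ ≤ R) : (bumpFn R).1 p = 1 := by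
  refine bump.one_of_mem_closedBall ?_
  rw [mem_closedBall_zero_iff, norm_smul, norm_inv, Real.norm_of_nonneg hR.le]
  change R⁻¹ * ‖p‖ ≤ 1
  rw [inv_mul_le_iff₀ hR, mul_one]
  exact hp

theorem bumpFn_eq_zero {R : ℝ} (hR : 0 < R) {p : ℝ × ℝ} (hp : 2 * R ≤ ‖p‖) :
    (bumpFn R).1 p = 0 := by
  refine bump.zero_of_le_dist ?_
  rw [dist_zero_right, norm_smul, norm_inv, Real.norm_of_nonneg hR.le]
  change 2 ≤ R⁻¹ * ‖p‖
  rw [le_inv_mul_iff₀ hR]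
  linarith

theorem pd_bumpFn (R : ℝ) (k : Fin 2) (p : ℝ × ℝ) :
    (pd k (bumpFn R)).1 p = R⁻¹ * fderiv ℝ bump (R⁻¹ • p) (dir k) := by
  have h1 : DifferentiableAt ℝ bump (R⁻¹ • p) :=
    (bump.contDiff (n := ⊤)).differentiable (by simp) _
  have h2 : HasFDerivAt (fun q : ℝ × ℝ => bump (R⁻¹ • q)) _ p :=
    h1.hasFDerivAt.comp p ((hasFDerivAt_id p).const_smul R⁻¹)
  change fderiv ℝ (fun q : ℝ × ℝ => bump (R⁻¹ • q)) p (dir k) = _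
  rw [h2.fderiv]
  simp

theorem exists_abs_pd_bumpFn_le :
    ∃ C : ℝ, 0 ≤ C ∧ ∀ R : ℝ, 0 < R → ∀ k p, |(pd k (bumpFn R)).1 p| ≤ C / R := by
  have hc : Continuous (fderiv ℝ bump) := (bump.contDiff (n := ⊤)).continuous_fderiv (by simp)
  obtain ⟨C, hC⟩ := (bump.hasCompactSupport.fderiv (𝕜 := ℝ)).exists_bound_of_continuous hc
  have hC0 : 0 ≤ C := (norm_nonneg _).trans (hC 0)
  have hd : ∀ k, ‖dir k‖ ≤ 1 := fun k => by fin_cases k <;> simp [dir, Prod.norm_def]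
  refine ⟨C, hC0, fun R hR k p => ?_⟩
  rw [pd_bumpFn, abs_mul, abs_of_pos (inv_pos.2 hR), mul_comm, ← div_eq_mul_inv]
  refine div_le_div_of_nonneg_right ?_ hR.le
  calc _ ≤ ‖fderiv ℝ bump (R⁻¹ • p)‖ * ‖dir k‖ := (fderiv ℝ bump (R⁻¹ • p)).le_opNorm _
    _ ≤ C * 1 := mul_le_mul (hC _) (hd k) (norm_nonneg _) hC0
    _ = C := mul_one C

theorem pd_bumpFn_eq_zero {R : ℝ} (hR : 0 < R) (k : Fin 2) {p : ℝ × ℝ} (hp : 2 * R < ‖p‖) :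
    (pd k (bumpFn R)).1 p = 0 := by
  have h : (bumpFn R).1 =ᶠ[nhds p] fun _ => 0 := by
    filter_upwards [(isOpen_lt continuous_const continuous_norm).mem_nhds hp] with q hq
    exact bumpFn_eq_zero hR (le_of_lt hq)
  change fderiv ℝ (bumpFn R).1 p (dir k) = 0
  rw [h.fderiv_eq]
  simp

/-- The product of a smooth function with a bump function. -/
def localize (w : ℝ × ℝ → ℂ) (hw : ContDiff ℝ ∞ w) (R : ℝ) (hR : 0 < R) : testSpace :=
  ⟨fun p => ((bumpFn R).1 p : ℂ) * w p,
    (Complex.ofRealCLM.contDiff.comp (contDiff_smoothFn (bumpFn R))).mul hw,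
    HasCompactSupport.mul_right (f := fun p => ((bumpFn R).1 p : ℂ))
      (HasCompactSupport.intro (isCompact_closedBall (0 : ℝ × ℝ) (2 * R)) fun p hp => by
        rw [mem_closedBall_zero_iff, not_le] at hp
        simp [bumpFn_eq_zero hR hp.le])⟩

theorem localize_apply {w : ℝ × ℝ → ℂ} (hw : ContDiff ℝ ∞ w) {R : ℝ} (hR : 0 < R) {p : ℝ × ℝ}
    (hp : ‖p‖ ≤ R) : (localize w hw R hR).1 p = w p := by
  change ((bumpFn R).1 p : ℂ) * w p = w p
  rw [bumpFn_eq_one hR hp]; simp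

theorem inner_localize {w : ℝ × ℝ → ℂ} (hw : ContDiff ℝ ∞ w) {R : ℝ} (hR : 0 < R)
    (φ : testSpace) (hφ : ∀ p, R < ‖p‖ → φ.1 p = 0) :
    inner ℂ (toL2 (localize w hw R hR)) (toL2 φ) = ∫ p, (starRingEnd ℂ) (w p) * φ.1 p := by
  rw [inner_toL2]
  congr 1; ext p
  rcases le_or_gt ‖p‖ R with hp | hp
  · rw [localize_apply hw hR hp]
  · rw [hφ p hp]; simp

theorem shifted_conj_inner (z : ℂ) (u φ : testSpace) :
    inner ℂ (toL2 u) (toL2 (shifted z φ)) =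
      inner ℂ (toL2 (shifted ((starRingEnd ℂ) z) u)) (toL2 φ) := by
  simp only [shifted, map_sub, map_smul, inner_sub_left, inner_sub_right, inner_smul_left,
    inner_smul_right, inner_exprLin, Complex.conj_conj]

section

variable {w : ℝ × ℝ → ℂ} {V ε : ℝ} {z : ℂ}

theorem norm_mulL_localize_le (hw : ContDiff ℝ ∞ w)
    (ha : ∀ φ : testSpace, ‖∫ p, (starRingEnd ℂ) (w p) * φ.1 p‖ ≤ V * ‖toL2 φ‖)
    {R : ℝ} (hR : 0 < R) (ζ : smoothFn) {c : ℝ} (hc : 0 ≤ c) (hV : 0 ≤ V)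
    (hζ : ∀ p, |ζ.1 p| ≤ c) (hζ0 : ∀ p, R < ‖p‖ → ζ.1 p = 0) :
    ‖toL2 (mulL ζ (localize w hw R hR))‖ ≤ c * V := by
  set u := localize w hw R hR
  have h1 : (‖toL2 (mulL ζ u)‖ : ℝ) ^ 2 ≤ V * (c * ‖toL2 (mulL ζ u)‖) := by
    have h2 : inner ℂ (toL2 u) (toL2 (mulL ζ (mulL ζ u))) = ((‖toL2 (mulL ζ u)‖ ^ 2 : ℝ) : ℂ) := by
      rw [← inner_mulL]
      simp
    have h3 := ha (mulL ζ (mulL ζ u))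
    rw [← inner_localize hw hR _ (fun p hp => by rw [mulL_apply, hζ0 p hp]; simp), h2,
      Complex.norm_real, Real.norm_of_nonneg (by positivity)] at h3
    exact h3.trans (mul_le_mul_of_nonneg_left (norm_mulL_le hζ _) hV)
  rcases (norm_nonneg (toL2 (mulL ζ u))).eq_or_lt' with h | h
  · rw [h]; positivity
  · refine le_of_mul_le_mul_right ?_ h
    calc _ = ‖toL2 (mulL ζ u)‖ ^ 2 := by ring
      _ ≤ _ := h1
      _ = _ := by ring

theorem norm_bump_localize_sq_le (hw : ContDiff ℝ ∞ w) (hV : 0 ≤ V) (hε : 0 ≤ ε)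
    (ha : ∀ φ : testSpace, ‖∫ p, (starRingEnd ℂ) (w p) * φ.1 p‖ ≤ V * ‖toL2 φ‖)
    (hb : ∀ φ : testSpace, ‖∫ p, (starRingEnd ℂ) (w p) * (shifted z φ).1 p‖ ≤ ε * V * ‖toL2 φ‖) :
    ∃ K : ℝ, ∀ R : ℝ, ∀ hR : 1 ≤ R,
      z.im * ‖toL2 (mulL (bumpFn R) (localize w hw (2 * R) (by positivity)))‖ ^ 2 ≤
        (ε + K / √R) * V ^ 2 := by
  obtain ⟨C, hC0, hC⟩ := exists_abs_pd_bumpFn_le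
  set B := 4 * (ε + |z.re| + 2) + 16 * C ^ 2 with hB
  have hB0 : 0 ≤ B := by positivity
  refine ⟨2 * C * √B, fun R hR => ?_⟩
  have hR0 : 0 < R := by linarith
  set a := bumpFn R with ha_def
  set u := localize w hw (2 * R) (by positivity) with hu
  set φ := mulL (a * a) u with hφ
  have hsupp : ∀ p, 2 * R < ‖p‖ → a.1 p = 0 := fun p hp => bumpFn_eq_zero hR0 hp.le
  have hts : tsupport φ.1 ⊆ Metric.closedBall 0 (2 * R) := by
    refine closure_minimal (fun p hp => ?_) Metric.isClosed_closedBall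
    by_contra hcon
    rw [mem_closedBall_zero_iff, not_le] at hcon
    apply hp
    rw [hφ, mulL_apply, coe_mul_apply, hsupp p hcon]
    simp
  have hau : ‖toL2 (mulL a u)‖ ≤ V := by
    have := norm_mulL_localize_le hw ha (show 0 < 2 * R by positivity) a zero_le_one hV
      (abs_bumpFn_le R) hsupp
    rwa [one_mul] at this
  have hdau : ∀ k, ‖toL2 (mulL (pd k a) u)‖ ≤ C / R * V := fun k =>
    norm_mulL_localize_le hw ha (show 0 < 2 * R by positivity) (pd k a) (by positivity) hV
      (hC R hR0 k) (fun p hp => pd_bumpFn_eq_zero hR0 k hp)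
  have hφn : ‖toL2 φ‖ ≤ V := by
    rw [hφ, ← mulL_mulL]
    have := norm_mulL_le (abs_bumpFn_le R) (mulL a u)
    rw [one_mul] at this
    exact this.trans hau
  have hflux : ‖inner ℂ (toL2 φ) (toL2 (shifted ((starRingEnd ℂ) z) u))‖ ≤ ε * V ^ 2 := by
    rw [norm_inner_symm, ← shifted_conj_inner, inner_localize hw _ _ (fun p hp =>
      shifted_apply_eq_zero z φ fun h => not_lt.2 (mem_closedBall_zero_iff.1 (hts h)) hp)]
    calc _ ≤ ε * V * ‖toL2 φ‖ := hb φ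
      _ ≤ ε * V * V := mul_le_mul_of_nonneg_left hφn (by positivity)
      _ = _ := by ring
  have hcross : ∀ k, ‖inner ℂ (toL2 (mulL (pd k (a * a)) u)) (toL2 (mom k u))‖ ≤
      2 * (C / R * V * ‖toL2 (mulL a (mom k u))‖) := by
    intro k
    have e : pd k (a * a) = (2 : ℝ) • (a * pd k a) := by
      rw [pd_mul, two_smul]; ring
    have e2 : mulL (pd k (a * a)) u = (2 : ℂ) • mulL a (mulL (pd k a) u) := by
      rw [e, mulL_mulL]
      refine test_ext fun p => ?_
      rw [mulL_apply, test_smul_apply, mulL_apply, coe_smul_apply]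
      push_cast; ring
    rw [e2, map_smul, inner_smul_left, norm_mul, inner_mulL, map_ofNat]
    have h1 := norm_inner_le_norm (𝕜 := ℂ) (toL2 (mulL (pd k a) u)) (toL2 (mulL a (mom k u)))
    have h2 := mul_le_mul_of_nonneg_right (hdau k) (norm_nonneg (toL2 (mulL a (mom k u))))
    have h3 : ‖(2 : ℂ)‖ = 2 := by simp
    rw [h3]
    linarith
  have hquad : |quad (a * a) u| ≤ V ^ 2 := by
    rw [quad_mul_self, abs_of_nonneg (by positivity)]
    exact pow_le_pow_left₀ (norm_nonneg _) hau 2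
  have hquadx : |quad (coordX * (a * a)) u| ≤ 2 * R * V ^ 2 := by
    have h1 : ∀ p, |(coordX * (a * a)).1 p| ≤ 2 * R * (a * a).1 p := by
      intro p
      rw [coe_mul_apply, coe_mul_apply, abs_mul, abs_of_nonneg (mul_self_nonneg (a.1 p))]
      rcases lt_or_ge (2 * R) ‖p‖ with hp | hp
      · rw [hsupp p hp]; simp
      · refine mul_le_mul_of_nonneg_right ?_ (mul_self_nonneg _)
        exact (norm_fst_le p).trans hp
    have h2 := quad_mono (a := coordX * (a * a)) (b := (2 * R) • (a * a))
      (fun p => (le_abs_self _).trans (h1 p)) u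
    have h3 := quad_mono (a := (-(2 * R)) • (a * a)) (b := coordX * (a * a))
      (fun p => by
        have := (neg_le_abs _).trans (h1 p)
        rw [coe_smul_apply]; linarith) u
    rw [quad_smul] at h2 h3
    have h4 := mul_le_mul_of_nonneg_left ((le_abs_self _).trans hquad)
      (show 0 ≤ 2 * R by positivity)
    rw [abs_le]
    constructor <;> linarith
  have hE := local_energy (a * a) ((starRingEnd ℂ) z) u
  have hF := local_flux (a * a) ((starRingEnd ℂ) z) u
  rw [quad_mul_self, quad_mul_self, Complex.conj_re] at hE
  rw [Complex.conj_im, quad_mul_self] at hF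
  set m₀ := ‖toL2 (mulL a (mom 0 u))‖ with hm₀
  set m₁ := ‖toL2 (mulL a (mom 1 u))‖ with hm₁
  have hm₀' : 0 ≤ m₀ := norm_nonneg _
  have hm₁' : 0 ≤ m₁ := norm_nonneg _
  have hc0 := hcross 0
  have hc1 := hcross 1
  have i0 := (Complex.im_le_norm _).trans hc0
  have i1 := (Complex.im_le_norm _).trans hc1
  have r0 := (abs_le.1 ((Complex.abs_re_le_norm _).trans hc0)).1
  have r1 := (abs_le.1 ((Complex.abs_re_le_norm _).trans hc1)).1
  have f1 := (Complex.re_le_norm _).trans hflux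
  have f2 := (Complex.im_le_norm _).trans hflux
  have hre : z.re * quad (a * a) u ≤ |z.re| * V ^ 2 := by
    refine (le_abs_self _).trans ?_
    rw [abs_mul]
    exact mul_le_mul_of_nonneg_left hquad (abs_nonneg _)
  have hx := (abs_le.1 hquadx).1
  set D := C / R * V with hD
  have hDV : D ≤ C * V := mul_le_mul_of_nonneg_right (div_le_self hC0 hR) hV
  have hD0 : 0 ≤ D := by positivity
  have hsum : m₀ ^ 2 + m₁ ^ 2 ≤ (ε + |z.re| + 2 * R) * V ^ 2 + 2 * (D * (m₀ + m₁)) := by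
    linarith
  have hm : (m₀ + m₁) ^ 2 ≤ R * B * V ^ 2 := by
    have h1 : (m₀ + m₁) ^ 2 ≤ 2 * (m₀ ^ 2 + m₁ ^ 2) := by linarith [sq_nonneg (m₀ - m₁)]
    have h2 : 4 * (D * (m₀ + m₁)) ≤ (m₀ + m₁) ^ 2 / 2 + 8 * D ^ 2 := by
      linarith [sq_nonneg (m₀ + m₁ - 4 * D)]
    have h3 : D ^ 2 ≤ C ^ 2 * V ^ 2 := by
      rw [← mul_pow]; exact pow_le_pow_left₀ hD0 hDV 2
    have h4 : (m₀ + m₁) ^ 2 ≤ (4 * (ε + |z.re| + 2 * R) + 16 * C ^ 2) * V ^ 2 := by linarith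
    refine h4.trans (mul_le_mul_of_nonneg_right ?_ (by positivity))
    have h5 : ε + |z.re| ≤ R * (ε + |z.re|) := le_mul_of_one_le_left (by positivity) hR
    have h6 : C ^ 2 ≤ R * C ^ 2 := le_mul_of_one_le_left (by positivity) hR
    rw [hB]
    linarith
  have hm' : m₀ + m₁ ≤ √R * √B * V := by
    refine abs_le_of_sq_le_sq' ?_ (by positivity) |>.2
    rw [mul_pow, mul_pow, Real.sq_sqrt hR0.le, Real.sq_sqrt hB0]
    exact hm
  have hfin : D * (m₀ + m₁) ≤ C * √B / √R * V ^ 2 := by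
    calc D * (m₀ + m₁) ≤ D * (√R * √B * V) := mul_le_mul_of_nonneg_left hm' hD0
      _ = C * √B / √R * V ^ 2 := by
          rw [hD]
          have h0 : 0 < √R := Real.sqrt_pos.2 hR0
          field_simp
          rw [Real.sq_sqrt hR0.le]
          ring
  have e : (ε + 2 * C * √B / √R) * V ^ 2 = ε * V ^ 2 + 2 * (C * √B / √R * V ^ 2) := by ring
  rw [e]
  linarith

theorem norm_pairing_sq_le (hw : ContDiff ℝ ∞ w) (hz : 0 < z.im) (hV : 0 ≤ V) (hε : 0 ≤ ε)
    (ha : ∀ φ : testSpace, ‖∫ p, (starRingEnd ℂ) (w p) * φ.1 p‖ ≤ V * ‖toL2 φ‖)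
    (hb : ∀ φ : testSpace, ‖∫ p, (starRingEnd ℂ) (w p) * (shifted z φ).1 p‖ ≤ ε * V * ‖toL2 φ‖)
    (φ : testSpace) :
    z.im * ‖∫ p, (starRingEnd ℂ) (w p) * φ.1 p‖ ^ 2 ≤ ε * V ^ 2 * ‖toL2 φ‖ ^ 2 := by
  obtain ⟨K, hK⟩ := norm_bump_localize_sq_le hw hV hε ha hb
  obtain ⟨r, hr⟩ := φ.2.2.isCompact.isBounded.subset_closedBall 0
  have hφ : ∀ p, r < ‖p‖ → φ.1 p = 0 := fun p hp => image_eq_zero_of_notMem_tsupport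
    fun h => not_lt.2 (mem_closedBall_zero_iff.1 (hr h)) hp
  have hlim : Filter.Tendsto (fun R : ℝ => (ε + K / √R) * V ^ 2 * ‖toL2 φ‖ ^ 2) Filter.atTop
      (nhds ((ε + 0) * V ^ 2 * ‖toL2 φ‖ ^ 2)) := by
    refine ((Filter.Tendsto.add tendsto_const_nhds ?_).mul_const _).mul_const _
    exact Filter.Tendsto.div_atTop tendsto_const_nhds Real.tendsto_sqrt_atTop
  rw [add_zero] at hlim
  refine ge_of_tendsto hlim ?_
  filter_upwards [Filter.eventually_ge_atTop 1, Filter.eventually_ge_atTop r] with R hR hrR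
  have hR0 : 0 < R := by linarith
  have h1 : ∫ p, (starRingEnd ℂ) (w p) * φ.1 p =
      inner ℂ (toL2 (mulL (bumpFn R) (localize w hw (2 * R) (by positivity)))) (toL2 φ) := by
    have h2 : mulL (bumpFn R) φ = φ := test_ext fun p => by
      rw [mulL_apply]
      rcases le_or_gt ‖p‖ R with hp | hp
      · rw [bumpFn_eq_one hR0 hp]; simp
      · rw [hφ p (by linarith)]; simp
    rw [inner_mulL, h2, inner_localize hw _ _ fun p hp => hφ p (by linarith)]
  rw [h1]
  calc _ ≤ z.im * (‖toL2 (mulL (bumpFn R) (localize w hw (2 * R) (by positivity)))‖ *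
        ‖toL2 φ‖) ^ 2 := by gcongr; exact norm_inner_le_norm _ _
    _ = z.im * ‖toL2 (mulL (bumpFn R) (localize w hw (2 * R) (by positivity)))‖ ^ 2 *
        ‖toL2 φ‖ ^ 2 := by ring
    _ ≤ _ := mul_le_mul_of_nonneg_right (hK R hR) (by positivity)

end

/-! ### Magnetic translations and mollification -/

/-- The phase of the magnetic translations. -/
def phase (t : ℝ) : ℂ := Complex.exp (-Complex.I * (t : ℂ))

theorem contDiff_phase : ContDiff ℝ ∞ phase :=
  (contDiff_const.mul Complex.ofRealCLM.contDiff).cexp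

theorem norm_phase (t : ℝ) : ‖phase t‖ = 1 := by
  rw [phase, neg_mul, mul_comm, ← neg_mul, ← Complex.ofReal_neg, Complex.norm_exp_ofReal_mul_I]

theorem conj_phase (t : ℝ) : (starRingEnd ℂ) (phase t) = phase (-t) := by
  rw [phase, phase, ← Complex.exp_conj]
  simp

theorem hasDerivAt_phase (t : ℝ) : HasDerivAt phase (-Complex.I * phase t) t := by
  have h1 : HasDerivAt (fun t : ℝ => -Complex.I * (t : ℂ)) (-Complex.I) t := by
    simpa using (Complex.ofRealCLM.hasDerivAt (x := t)).const_mul (-Complex.I)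
  have := h1.cexp
  rwa [mul_comm] at this

/-- The magnetic translation by `h`. -/
def magTrans (h : ℝ × ℝ) (φ : testSpace) : testSpace :=
  ⟨fun q => phase (h.2 * (q.1 - h.1)) * φ.1 (q - h),
    (contDiff_phase.comp (by fun_prop)).mul (φ.2.1.comp (by fun_prop)),
    (φ.2.2.comp_homeomorph (Homeomorph.subRight h)).mul_left
      (f := fun q : ℝ × ℝ => phase (h.2 * (q.1 - h.1)))⟩

theorem magTrans_apply (h : ℝ × ℝ) (φ : testSpace) (q : ℝ × ℝ) :
    (magTrans h φ).1 q = phase (h.2 * (q.1 - h.1)) * φ.1 (q - h) := rfl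

theorem mom_magTrans (h : ℝ × ℝ) (k : Fin 2) (φ : testSpace) :
    mom k (magTrans h φ) = magTrans h (mom k φ) := by
  refine test_ext fun q => ?_
  have h1 : HasFDerivAt (fun q : ℝ × ℝ => h.2 * (q.1 - h.1)) (h.2 • ContinuousLinearMap.fst ℝ ℝ ℝ)
      q := ((ContinuousLinearMap.fst ℝ ℝ ℝ).hasFDerivAt.sub_const h.1).const_mul h.2
  have h2 : HasFDerivAt (fun q : ℝ × ℝ => phase (h.2 * (q.1 - h.1))) _ q :=
    (hasDerivAt_phase _).hasFDerivAt.comp q h1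
  have h3 : HasFDerivAt (fun q : ℝ × ℝ => φ.1 (q - h)) (fderiv ℝ φ.1 (q - h)) q := by
    have := (differentiable_of_mem φ.2 (q - h)).hasFDerivAt.comp q ((hasFDerivAt_id q).sub_const h)
    rw [ContinuousLinearMap.comp_id] at this
    exact this
  have h4 : HasFDerivAt (magTrans h φ).1 _ q := h2.mul h3
  rw [mom_apply, h4.fderiv, magTrans_apply, magTrans_apply, mom_apply]
  fin_cases k
  · simp [dir, vecPot, coordY]
    linear_combination (phase (h.2 * (q.1 - h.1)) * φ.1 (q - h) * h.2) * Complex.I_mul_I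
  · simp [dir, vecPot]
    ring

theorem magTrans_shifted (h : ℝ × ℝ) (z : ℂ) (φ : testSpace) :
    magTrans h (shifted z φ) = shifted z (magTrans h φ) - (h.1 : ℂ) • magTrans h φ := by
  refine test_ext fun q => ?_
  simp only [shifted, exprLin_eq, mom_magTrans, magTrans_apply, test_sub_apply, test_add_apply,
    test_smul_apply, mulL_apply, coordX, Prod.fst_sub, Complex.ofReal_sub]
  ring

theorem norm_toL2_sq (φ : testSpace) : ‖toL2 φ‖ ^ 2 = ∫ p, ‖φ.1 p‖ ^ 2 := by
  rw [← quad_one, quad]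
  simp

theorem norm_magTrans (h : ℝ × ℝ) (φ : testSpace) : ‖toL2 (magTrans h φ)‖ = ‖toL2 φ‖ := by
  have h1 : ‖toL2 (magTrans h φ)‖ ^ 2 = ‖toL2 φ‖ ^ 2 := by
    rw [norm_toL2_sq, norm_toL2_sq]
    simp only [magTrans_apply, norm_mul, norm_phase, one_mul]
    exact integral_sub_right_eq_self (fun p => ‖φ.1 p‖ ^ 2) h
  exact (pow_left_inj₀ (norm_nonneg _) (norm_nonneg _) two_ne_zero).1 h1

theorem inner_toL2_right (v : L2) (φ : testSpace) :
    inner ℂ v (toL2 φ) = ∫ p, (starRingEnd ℂ) (v p) * φ.1 p := by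
  rw [L2.inner_def]
  refine integral_congr_ae ?_
  filter_upwards [(memLp_of_mem φ.2).coeFn_toLp] with p h2
  change inner ℂ (v p) ((memLp_of_mem φ.2).toLp φ.1 p) = _
  rw [h2]
  simp [mul_comm]

theorem locallyIntegrable_L2 (v : L2) : LocallyIntegrable v volume :=
  (Lp.memLp v).locallyIntegrable (by norm_num)

theorem locallyIntegrable_conj_L2 (v : L2) :
    LocallyIntegrable (fun q => (starRingEnd ℂ) (v q)) volume := by
  intro x
  obtain ⟨s, hs, hi⟩ := locallyIntegrable_L2 v x
  refine ⟨s, hs, Integrable.mono hi (Complex.continuous_conj.comp_aestronglyMeasurable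
    hi.aestronglyMeasurable) (Filter.Eventually.of_forall fun q => ?_)⟩
  simp

/-- Magnetic mollification. -/
def mollify (ρ : ℝ × ℝ → ℝ) (v : ℝ × ℝ → ℂ) (p : ℝ × ℝ) : ℂ :=
  ∫ q, v q * ((ρ (q - p) : ℂ) * phase (-((q.2 - p.2) * p.1)))

theorem contDiff_mollify {ρ : ℝ × ℝ → ℝ} (hρ : ContDiff ℝ ∞ ρ) (hρc : HasCompactSupport ρ)
    {v : ℝ × ℝ → ℂ} (hv : LocallyIntegrable v volume) : ContDiff ℝ ∞ (mollify ρ v) := by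
  set g : ℝ × ℝ → ℝ × ℝ → ℂ := fun p x => (ρ (-x) : ℂ) * phase (x.2 * p.1) with hg
  have hk : IsCompact ((fun x : ℝ × ℝ => -x) '' tsupport ρ) :=
    hρc.isCompact.image continuous_neg
  have key := contDiffOn_convolution_right_with_param (𝕜 := ℝ) (n := ⊤) (f := v) (g := g)
    (s := Set.univ) (μ := volume) (ContinuousLinearMap.mul ℝ ℂ) isOpen_univ hk
    (fun p x _ hx => by
      have : ρ (-x) = 0 := image_eq_zero_of_notMem_tsupport fun h => hx ⟨-x, h, neg_neg x⟩
      simp [hg, this])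
    hv
    (by
      refine ContDiff.contDiffOn ?_
      exact (Complex.ofRealCLM.contDiff.comp (hρ.comp (contDiff_snd.neg))).mul
        (contDiff_phase.comp ((contDiff_snd.comp contDiff_snd).mul
          (contDiff_fst.comp contDiff_fst))))
  rw [Set.univ_prod_univ, contDiffOn_univ] at key
  have h2 : mollify ρ v = fun p => (convolution v (g p) (ContinuousLinearMap.mul ℝ ℂ) volume) p := by
    funext p
    simp only [mollify, convolution, hg, ContinuousLinearMap.mul_apply', neg_sub, Prod.snd_sub]
    congr 1; ext q; ring_nf
  rw [h2]
  exact key.comp (contDiff_id.prodMk contDiff_id)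

theorem integrable_kernel_mul {k : (ℝ × ℝ) × (ℝ × ℝ) → ℂ} (hk : Continuous k)
    (hkc : HasCompactSupport k) {v : ℝ × ℝ → ℂ} (hv : LocallyIntegrable v volume) :
    Integrable (fun x : (ℝ × ℝ) × (ℝ × ℝ) => k x * v x.2) (volume.prod volume) := by
  obtain ⟨C, hC⟩ := hkc.exists_bound_of_continuous hk
  set K₁ := Prod.fst '' tsupport k
  set K₂ := Prod.snd '' tsupport k
  have hK₁ : IsCompact K₁ := hkc.isCompact.image continuous_fst
  have hK₂ : IsCompact K₂ := hkc.isCompact.image continuous_snd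
  have i1 : Integrable (K₁.indicator fun _ => (C : ℂ)) (volume : Measure (ℝ × ℝ)) :=
    (integrable_indicator_iff hK₁.measurableSet).2 (integrableOn_const hK₁.measure_lt_top.ne)
  have i2 : Integrable (K₂.indicator v) volume :=
    (integrable_indicator_iff hK₂.measurableSet).2 (hv.integrableOn_isCompact hK₂)
  refine (i1.mul_prod i2).mono ?_ (Filter.Eventually.of_forall fun x => ?_)
  · exact hk.aestronglyMeasurable.mul (hv.aestronglyMeasurable.comp_snd)
  · by_cases hx : x ∈ tsupport k
    · rw [Set.indicator_of_mem (Set.mem_image_of_mem _ hx),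
        Set.indicator_of_mem (Set.mem_image_of_mem _ hx), norm_mul, norm_mul, Complex.norm_real]
      exact mul_le_mul_of_nonneg_right ((hC x).trans (le_abs_self C)) (norm_nonneg _)
    · rw [image_eq_zero_of_notMem_tsupport hx, zero_mul, norm_zero]
      exact norm_nonneg _

theorem integral_kernel_swap {k : (ℝ × ℝ) × (ℝ × ℝ) → ℂ} (hk : Continuous k)
    (hkc : HasCompactSupport k) {v : ℝ × ℝ → ℂ} (hv : LocallyIntegrable v volume) :
    ∫ p, ∫ q, k (p, q) * v q = ∫ q, ∫ p, k (p, q) * v q :=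
  integral_integral_swap (integrable_kernel_mul hk hkc hv)

theorem pairing_mollify {ρ : ℝ × ℝ → ℝ} (hρ : ContDiff ℝ ∞ ρ) (hρc : HasCompactSupport ρ)
    (v : L2) (φ : testSpace) :
    ∫ p, (starRingEnd ℂ) (mollify ρ v p) * φ.1 p =
      ∫ h, (ρ h : ℂ) * inner ℂ v (toL2 (magTrans h φ)) := by
  have hv' : LocallyIntegrable (fun q => (starRingEnd ℂ) (v q)) volume :=
    locallyIntegrable_conj_L2 v
  set k₁ : (ℝ × ℝ) × (ℝ × ℝ) → ℂ := fun x =>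
    (ρ (x.2 - x.1) : ℂ) * phase ((x.2.2 - x.1.2) * x.1.1) * φ.1 x.1 with hk₁
  set k₂ : (ℝ × ℝ) × (ℝ × ℝ) → ℂ := fun x => (ρ x.1 : ℂ) * (magTrans x.1 φ).1 x.2 with hk₂
  have hρ' := hρ.continuous
  have hφ' := φ.2.1.continuous
  have hph := contDiff_phase.continuous
  have c₁ : Continuous k₁ := by rw [hk₁]; fun_prop
  have c₂ : Continuous k₂ := by simp only [hk₂, magTrans_apply]; fun_prop
  have s₁ : HasCompactSupport k₁ := by
    refine HasCompactSupport.intro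
      (K := (fun x : (ℝ × ℝ) × (ℝ × ℝ) => (x.1, x.1 + x.2)) '' (tsupport φ.1 ×ˢ tsupport ρ))
      ((φ.2.2.isCompact.prod hρc.isCompact).image (by fun_prop)) fun x hx => ?_
    by_cases h1 : x.1 ∈ tsupport φ.1
    · have h2 : x.2 - x.1 ∉ tsupport ρ := fun h2 => hx
        ⟨(x.1, x.2 - x.1), ⟨h1, h2⟩, by simp⟩
      simp [hk₁, image_eq_zero_of_notMem_tsupport h2]
    · simp [hk₁, image_eq_zero_of_notMem_tsupport h1]
  have s₂ : HasCompactSupport k₂ := by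
    refine HasCompactSupport.intro
      (K := (fun x : (ℝ × ℝ) × (ℝ × ℝ) => (x.1, x.2 + x.1)) '' (tsupport ρ ×ˢ tsupport φ.1))
      ((hρc.isCompact.prod φ.2.2.isCompact).image (by fun_prop)) fun x hx => ?_
    by_cases h1 : x.1 ∈ tsupport ρ
    · have h2 : x.2 - x.1 ∉ tsupport φ.1 := fun h2 => hx
        ⟨(x.1, x.2 - x.1), ⟨h1, h2⟩, by simp⟩
      simp [hk₂, magTrans_apply, image_eq_zero_of_notMem_tsupport h2]
    · simp [hk₂, image_eq_zero_of_notMem_tsupport h1]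
  calc ∫ p, (starRingEnd ℂ) (mollify ρ v p) * φ.1 p
      = ∫ p, ∫ q, k₁ (p, q) * (starRingEnd ℂ) (v q) := by
        congr 1; ext p
        rw [mollify, ← integral_conj, ← integral_mul_const]
        congr 1; ext q
        simp only [hk₁, map_mul, Complex.conj_ofReal, conj_phase, neg_neg]
        ring
    _ = ∫ q, ∫ p, k₁ (p, q) * (starRingEnd ℂ) (v q) := integral_kernel_swap c₁ s₁ hv'
    _ = ∫ q, ∫ h, k₂ (h, q) * (starRingEnd ℂ) (v q) := by
        congr 1; ext q
        rw [← integral_sub_left_eq_self (fun p => k₁ (p, q) * (starRingEnd ℂ) (v q)) volume q]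
        congr 1; ext h
        simp only [hk₁, hk₂, magTrans_apply, sub_sub_cancel, Prod.snd_sub, Prod.fst_sub]
        ring
    _ = ∫ h, ∫ q, k₂ (h, q) * (starRingEnd ℂ) (v q) := (integral_kernel_swap c₂ s₂ hv').symm
    _ = _ := by
        congr 1; ext h
        rw [inner_toL2_right, ← integral_const_mul]
        congr 1; ext q
        simp only [hk₂]
        ring

theorem continuous_inner_magTrans (v : L2) (φ : testSpace) :
    Continuous fun h => inner ℂ v (toL2 (magTrans h φ)) := by
  simp only [inner_toL2_right]
  refine continuous_iff_continuousAt.2 fun h₀ => ?_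
  obtain ⟨C, hC⟩ := φ.2.2.exists_bound_of_continuous φ.2.1.continuous
  set K := (fun x : (ℝ × ℝ) × (ℝ × ℝ) => x.1 + x.2) ''
    (tsupport φ.1 ×ˢ Metric.closedBall h₀ 1)
  have hKc : IsCompact K :=
    (φ.2.2.isCompact.prod (isCompact_closedBall _ _)).image (by fun_prop)
  have hφ' := φ.2.1.continuous
  have hph := contDiff_phase.continuous
  refine continuousAt_of_dominated (bound := K.indicator fun q => C * ‖v q‖) ?_ ?_ ?_ ?_
  · refine Filter.Eventually.of_forall fun h => ?_
    exact (Complex.continuous_conj.comp_aestronglyMeasurable (Lp.aestronglyMeasurable v)).mul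
      (magTrans h φ).2.1.continuous.aestronglyMeasurable
  · filter_upwards [Metric.closedBall_mem_nhds h₀ one_pos] with h hh
    refine Filter.Eventually.of_forall fun q => ?_
    rw [norm_mul, RCLike.norm_conj, magTrans_apply, norm_mul, norm_phase, one_mul, mul_comm]
    by_cases hq : q - h ∈ tsupport φ.1
    · have hqK : q ∈ K := ⟨(q - h, h), ⟨hq, hh⟩, by simp⟩
      rw [Set.indicator_of_mem hqK]
      exact mul_le_mul_of_nonneg_right (hC _) (norm_nonneg _)
    · rw [image_eq_zero_of_notMem_tsupport hq, norm_zero, zero_mul]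
      exact Set.indicator_nonneg (fun q _ => mul_nonneg ((norm_nonneg _).trans (hC 0))
        (norm_nonneg _)) _
  · refine (integrable_indicator_iff hKc.measurableSet).2 ?_
    exact (((locallyIntegrable_L2 v).integrableOn_isCompact hKc).norm).const_mul C
  · refine Filter.Eventually.of_forall fun q => ?_
    simp only [magTrans_apply]
    fun_prop

theorem eq_zero_of_inner_toL2_eq_zero (v : L2) (h : ∀ φ : testSpace, inner ℂ v (toL2 φ) = 0) :
    v = 0 := by
  have h1 : ∀ᵐ p ∂(volume : Measure (ℝ × ℝ)), (starRingEnd ℂ) (v p) = 0 := by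
    refine ae_eq_zero_of_integral_contDiff_smul_eq_zero (locallyIntegrable_conj_L2 v)
      fun g hg hgc => ?_
    · have h2 := h ⟨fun p => (g p : ℂ), Complex.ofRealCLM.contDiff.comp hg,
        hgc.comp_left (g := fun t : ℝ => (t : ℂ)) Complex.ofReal_zero⟩
      rw [inner_toL2_right] at h2
      rw [← h2]
      congr 1; ext p
      rw [Complex.real_smul, mul_comm]
  refine Lp.ext ?_
  filter_upwards [h1, Lp.coeFn_zero (E := ℂ) (p := 2) (μ := (volume : Measure (ℝ × ℝ)))]
    with p h2 h3
  rw [h3]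
  simpa using h2

/-- A vector orthogonal to the range of `H - z` on test functions vanishes. -/
theorem eq_zero_of_inner_shifted_eq_zero {z : ℂ} (hz : 0 < z.im) (v : L2)
    (hv : ∀ φ : testSpace, inner ℂ v (toL2 (shifted z φ)) = 0) : v = 0 := by
  refine eq_zero_of_inner_toL2_eq_zero v fun φ => ?_
  have key : ∀ τ : ℝ, 0 < τ → ∀ ε : ℝ, 0 < ε →
      ‖inner ℂ v (toL2 φ)‖ ≤ τ + √(ε / z.im) * (‖v‖ * ‖toL2 φ‖) := by
    intro τ hτ ε hε
    have hcont := continuous_inner_magTrans v φ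
    obtain ⟨d, hd, hball⟩ := Metric.continuousAt_iff.1 (hcont.continuousAt (x := 0)) τ hτ
    have h0 : magTrans 0 φ = φ := test_ext fun q => by simp [magTrans_apply, phase]
    rw [h0] at hball
    set r := min d ε with hr
    have hr0 : 0 < r := lt_min hd hε
    let β : ContDiffBump (0 : ℝ × ℝ) := ⟨r / 2, r, by positivity, by linarith⟩
    set ρ := β.normed volume with hρ
    have hρ0 : ∀ h, 0 ≤ ρ h := fun h => β.nonneg_normed h
    have hρs : ∀ h, ρ h ≠ 0 → ‖h‖ < r := fun h hh => by
      have : h ∈ Function.support ρ := hh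
      rw [hρ, β.support_normed_eq] at this
      simpa using this
    have hρi : Integrable ρ volume := β.integrable_normed
    have hρ1 : ∫ h, ρ h = 1 := β.integral_normed
    have hρc : HasCompactSupport ρ := β.hasCompactSupport_normed
    have hρd : ContDiff ℝ ∞ ρ := β.contDiff_normed
    set w := mollify ρ v with hw
    have bound : ∀ (F : ℝ × ℝ → ℂ) (c : ℝ), (∀ h, ‖h‖ < r → ‖F h‖ ≤ c) →
        ‖∫ h, (ρ h : ℂ) * F h‖ ≤ c := by
      intro F c hF
      have h1 := norm_integral_le_of_norm_le (hρi.mul_const c) (f := fun h => (ρ h : ℂ) * F h)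
        (Filter.Eventually.of_forall fun h => by
          rw [norm_mul, Complex.norm_real, Real.norm_of_nonneg (hρ0 h)]
          by_cases hh : ρ h = 0
          · simp [hh]
          · exact mul_le_mul_of_nonneg_left (hF h (hρs h hh)) (hρ0 h))
      rwa [integral_mul_const, hρ1, one_mul] at h1
    have ha : ∀ ψ : testSpace, ‖∫ p, (starRingEnd ℂ) (w p) * ψ.1 p‖ ≤ ‖v‖ * ‖toL2 ψ‖ := by
      intro ψ
      rw [pairing_mollify hρd hρc]
      refine bound _ _ fun h _ => ?_
      rw [← norm_magTrans h ψ]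
      exact norm_inner_le_norm _ _
    have hb : ∀ ψ : testSpace,
        ‖∫ p, (starRingEnd ℂ) (w p) * (shifted z ψ).1 p‖ ≤ ε * ‖v‖ * ‖toL2 ψ‖ := by
      intro ψ
      rw [pairing_mollify hρd hρc]
      refine bound _ _ fun h hh => ?_
      rw [magTrans_shifted, map_sub, inner_sub_right, hv, zero_sub, norm_neg, map_smul,
        inner_smul_right, norm_mul, Complex.norm_real, mul_assoc]
      refine mul_le_mul ?_ ?_ (norm_nonneg _) hε.le
      · exact (norm_fst_le h).trans (hh.le.trans (min_le_right _ _))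
      · rw [← norm_magTrans h ψ]
        exact norm_inner_le_norm _ _
    have hP := norm_pairing_sq_le (contDiff_mollify hρd hρc (locallyIntegrable_L2 v)) hz
      (norm_nonneg v) hε.le ha hb φ
    have hdiff : ‖inner ℂ v (toL2 φ) - ∫ p, (starRingEnd ℂ) (w p) * φ.1 p‖ ≤ τ := by
      have hint : Integrable (fun h => (ρ h : ℂ) * inner ℂ v (toL2 (magTrans h φ))) volume :=
        ((Complex.continuous_ofReal.comp hρd.continuous).mul
          hcont).integrable_of_hasCompactSupport
          (HasCompactSupport.mul_right (f := fun h => (ρ h : ℂ))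
            (hρc.comp_left (g := fun t : ℝ => (t : ℂ)) Complex.ofReal_zero))
      have e : inner ℂ v (toL2 φ) - ∫ p, (starRingEnd ℂ) (w p) * φ.1 p =
          ∫ h, (ρ h : ℂ) * (inner ℂ v (toL2 φ) - inner ℂ v (toL2 (magTrans h φ))) := by
        simp only [mul_sub]
        have hρC : Integrable (fun h => (ρ h : ℂ)) volume := hρi.ofReal
        rw [integral_sub (hρC.mul_const (inner ℂ v (toL2 φ))) hint, integral_mul_const,
          integral_complex_ofReal, hρ1, pairing_mollify hρd hρc]
        simp
      rw [e]
      refine bound _ _ fun h hh => ?_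
      rw [norm_sub_rev, ← dist_eq_norm]
      exact (hball (by simpa using hh.trans_le (min_le_left _ _))).le
    have hw' : ‖∫ p, (starRingEnd ℂ) (w p) * φ.1 p‖ ≤ √(ε / z.im) * (‖v‖ * ‖toL2 φ‖) := by
      refine abs_le_of_sq_le_sq' ?_ (by positivity) |>.2
      rw [mul_pow, Real.sq_sqrt (by positivity)]
      refine le_of_mul_le_mul_left (hP.trans (le_of_eq ?_)) hz
      field_simp
    calc ‖inner ℂ v (toL2 φ)‖ = ‖(inner ℂ v (toL2 φ) - ∫ p, (starRingEnd ℂ) (w p) * φ.1 p) +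
          ∫ p, (starRingEnd ℂ) (w p) * φ.1 p‖ := by rw [sub_add_cancel]
      _ ≤ _ := (norm_add_le _ _).trans (add_le_add hdiff hw')
  have h1 : ∀ ε : ℝ, 0 < ε → ‖inner ℂ v (toL2 φ)‖ ≤ √(ε / z.im) * (‖v‖ * ‖toL2 φ‖) :=
    fun ε hε => le_of_forall_pos_le_add fun τ hτ => by
      have := key τ hτ ε hε
      linarith
  have hlim : Filter.Tendsto (fun ε : ℝ => √(ε / z.im) * (‖v‖ * ‖toL2 φ‖))
      (nhdsWithin 0 (Set.Ioi 0)) (nhds (√(0 / z.im) * (‖v‖ * ‖toL2 φ‖))) := by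
    refine Filter.Tendsto.mono_left (Continuous.tendsto ?_ 0) nhdsWithin_le_nhds
    fun_prop
  rw [zero_div, Real.sqrt_zero, zero_mul] at hlim
  have h2 := ge_of_tendsto hlim (Filter.eventually_of_mem self_mem_nhdsWithin fun ε hε => h1 ε hε)
  exact norm_le_zero_iff.1 h2

/-! ### The resolvent -/

theorem H0min_apply (φ : testSpace) :
    H0min ⟨toL2 φ, LinearMap.mem_range_self toL2 φ⟩ = toL2 (exprLin φ) := by
  change toL2 (exprLin ((LinearEquiv.ofInjective toL2 toL2_injective).symm _)) = _
  congr 2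
  exact (LinearEquiv.ofInjective toL2 toL2_injective).symm_apply_apply φ

theorem mem_graph_H0min {x : L2 × L2} :
    x ∈ H0min.graph ↔ ∃ φ : testSpace, x = (toL2 φ, toL2 (exprLin φ)) := by
  rw [LinearPMap.mem_graph_iff]
  constructor
  · rintro ⟨⟨_, φ, rfl⟩, h1, h2⟩
    exact ⟨φ, Prod.ext h1.symm (h2.symm.trans (H0min_apply φ))⟩
  · rintro ⟨φ, rfl⟩
    exact ⟨⟨toL2 φ, LinearMap.mem_range_self toL2 φ⟩, rfl, H0min_apply φ⟩

/-- The closure of the graph of the minimal operator. -/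
def closedGraph : Submodule ℂ (L2 × L2) := H0min.graph.topologicalClosure

theorem closedGraph_induction {P : L2 × L2 → Prop} (hP : IsClosed {x | P x})
    (h : ∀ φ : testSpace, P (toL2 φ, toL2 (exprLin φ))) {x : L2 × L2} (hx : x ∈ closedGraph) :
    P x := by
  refine closure_minimal (s := (H0min.graph : Set (L2 × L2))) (t := {x | P x}) ?_ hP hx
  intro y hy
  obtain ⟨φ, rfl⟩ := mem_graph_H0min.1 hy
  exact h φ

theorem isClosable_H0min : H0min.IsClosable := by
  refine ⟨closedGraph.toLinearPMap, (Submodule.toLinearPMap_graph_eq _ fun x hx hx0 => ?_).symm⟩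
  have key : ∀ φ : testSpace, inner ℂ x.2 (toL2 φ) = inner ℂ x.1 (toL2 (exprLin φ)) := fun φ =>
    closedGraph_induction
      (P := fun x => inner ℂ x.2 (toL2 φ) = inner ℂ x.1 (toL2 (exprLin φ)))
      (isClosed_eq (continuous_snd.inner continuous_const) (continuous_fst.inner continuous_const))
      (fun ψ => inner_exprLin ψ φ) hx
  refine eq_zero_of_inner_toL2_eq_zero _ fun φ => ?_
  rw [key φ, hx0, inner_zero_left]

theorem graph_H0 : H0.graph = closedGraph := isClosable_H0min.graph_closure_eq_closure_graph.symm

theorem mul_norm_toL2_le {z : ℂ} (u : testSpace) :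
    z.im * ‖toL2 u‖ ≤ ‖toL2 (shifted z u)‖ := by
  rcases (norm_nonneg (toL2 u)).eq_or_lt' with h | h
  · rw [h, mul_zero]; exact norm_nonneg _
  · refine le_of_mul_le_mul_left ?_ h
    calc ‖toL2 u‖ * (z.im * ‖toL2 u‖) = z.im * ‖toL2 u‖ ^ 2 := by ring
      _ = -(inner ℂ (toL2 u) (toL2 (shifted z u))).im := inner_shifted_self z u
      _ ≤ _ := (neg_le_abs _).trans ((Complex.abs_im_le_norm _).trans (norm_inner_le_norm _ _))

theorem toL2_shifted (z : ℂ) (u : testSpace) :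
    toL2 (shifted z u) = toL2 (exprLin u) - z • toL2 u := by
  rw [shifted, map_sub, map_smul]

theorem mul_norm_le_of_mem_closedGraph {z : ℂ} {x : L2 × L2} (hx : x ∈ closedGraph) :
    z.im * ‖x.1‖ ≤ ‖x.2 - z • x.1‖ := by
  refine closedGraph_induction (P := fun x => z.im * ‖x.1‖ ≤ ‖x.2 - z • x.1‖)
    (isClosed_le (by fun_prop) (by fun_prop)) (fun φ => ?_) hx
  rw [← toL2_shifted]
  exact mul_norm_toL2_le φ

/-- The operator `(x, y) ↦ y - z x` on the closed graph. -/
def graphMap (z : ℂ) : closedGraph →L[ℂ] L2 :=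
  (ContinuousLinearMap.snd ℂ L2 L2 - z • ContinuousLinearMap.fst ℂ L2 L2) ∘L closedGraph.subtypeL

theorem graphMap_apply (z : ℂ) (x : closedGraph) :
    graphMap z x = (x : L2 × L2).2 - z • (x : L2 × L2).1 := rfl

theorem mem_closedGraph (φ : testSpace) : (toL2 φ, toL2 (exprLin φ)) ∈ closedGraph :=
  H0min.graph.le_topologicalClosure (mem_graph_H0min.2 ⟨φ, rfl⟩)

theorem norm_le_norm_graphMap {z : ℂ} (hz : 0 < z.im) (x : closedGraph) :
    ‖x‖ ≤ (1 + (1 + ‖z‖) / z.im) * ‖graphMap z x‖ := by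
  have h1 : ‖(x : L2 × L2).1‖ ≤ ‖graphMap z x‖ / z.im := by
    rw [le_div_iff₀ hz, mul_comm]
    exact mul_norm_le_of_mem_closedGraph x.2
  have h2 : ‖(x : L2 × L2).2‖ ≤ ‖graphMap z x‖ + ‖z‖ * ‖(x : L2 × L2).1‖ := by
    have : (x : L2 × L2).2 = graphMap z x + z • (x : L2 × L2).1 := by
      rw [graphMap_apply, sub_add_cancel]
    rw [this, ← norm_smul]
    exact norm_add_le _ _
  have h3 := mul_le_mul_of_nonneg_left h1 (norm_nonneg z)
  have h4 : 0 ≤ ‖graphMap z x‖ / z.im := by positivity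
  have h5 : 0 ≤ ‖z‖ * (‖graphMap z x‖ / z.im) := by positivity
  have e : (1 + (1 + ‖z‖) / z.im) * ‖graphMap z x‖ =
      ‖graphMap z x‖ + ‖graphMap z x‖ / z.im + ‖z‖ * (‖graphMap z x‖ / z.im) := by ring
  rw [e]
  change ‖(x : L2 × L2)‖ ≤ _
  rw [Prod.norm_def]
  exact max_le (by linarith [norm_nonneg (graphMap z x)]) (by linarith)

theorem bijective_graphMap {z : ℂ} (hz : 0 < z.im) : Function.Bijective (graphMap z) := by
  have hanti : AntilipschitzWith ⟨1 + (1 + ‖z‖) / z.im, by positivity⟩ (graphMap z) :=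
    AddMonoidHomClass.antilipschitz_of_bound _ (norm_le_norm_graphMap hz)
  refine ⟨hanti.injective, ?_⟩
  have : CompleteSpace closedGraph :=
    H0min.graph.isClosed_topologicalClosure.completeSpace_coe
  have hcl : IsClosed (Set.range (graphMap z)) :=
    hanti.isClosed_range (graphMap z).uniformContinuous
  set K : Submodule ℂ L2 := LinearMap.range (graphMap z : closedGraph →ₗ[ℂ] L2) with hK
  have hKcl : IsClosed (K : Set L2) := hcl
  have : CompleteSpace K := hKcl.completeSpace_coe
  have hKt : K = ⊤ := by
    rw [← Submodule.orthogonal_eq_bot_iff, Submodule.eq_bot_iff]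
    intro v hv
    refine eq_zero_of_inner_shifted_eq_zero hz v fun φ => ?_
    rw [inner_eq_zero_symm]
    refine (Submodule.mem_orthogonal K v).1 hv _ ?_
    exact ⟨⟨_, mem_closedGraph φ⟩, (toL2_shifted z φ).symm⟩
  intro f
  have : f ∈ K := by rw [hKt]; trivial
  exact this

theorem exists_isResolvent {z : ℂ} (hz : 0 < z.im) :
    ∃ R : L2 →L[ℂ] L2, IsResolvent H0 z R ∧ (∀ f, ‖R f‖ ≤ z.im⁻¹ * ‖f‖) ∧
      ∀ f : L2, ∀ τ : ℝ, 0 < τ → ∃ u : testSpace,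
        ‖toL2 u - R f‖ ≤ τ ∧ ‖toL2 (shifted z u) - f‖ ≤ τ := by
  let S := LinearEquiv.ofBijective (graphMap z : closedGraph →ₗ[ℂ] L2) (bijective_graphMap hz)
  have hS : ∀ f, graphMap z (S.symm f) = f := fun f => S.apply_symm_apply f
  have hbd : ∀ f, ‖(S.symm f : L2 × L2).1‖ ≤ z.im⁻¹ * ‖f‖ := fun f => by
    rw [le_inv_mul_iff₀ hz]
    have := mul_norm_le_of_mem_closedGraph (z := z) (S.symm f).2
    rwa [← graphMap_apply, hS] at this
  let R : L2 →L[ℂ] L2 := LinearMap.mkContinuous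
    (LinearMap.fst ℂ L2 L2 ∘ₗ closedGraph.subtype ∘ₗ S.symm.toLinearMap) z.im⁻¹ hbd
  have hR : ∀ f, R f = (S.symm f : L2 × L2).1 := fun f => rfl
  have hgraph : ∀ f, ∃ y : H0.domain, (y : L2) = R f ∧ H0 y = (S.symm f : L2 × L2).2 := by
    intro f
    have h1 : (S.symm f : L2 × L2) ∈ H0.graph := by rw [graph_H0]; exact (S.symm f).2
    exact (LinearPMap.mem_graph_iff _).1 h1
  have hdom : ∀ f, R f ∈ H0.domain := fun f => by
    obtain ⟨y, h1, -⟩ := hgraph f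
    rw [← h1]; exact y.2
  have hval : ∀ f, H0 ⟨R f, hdom f⟩ = (S.symm f : L2 × L2).2 := fun f => by
    obtain ⟨y, h1, h2⟩ := hgraph f
    rw [← h2]
    congr 1
    exact Subtype.ext h1.symm
  refine ⟨R, ⟨hdom, fun f => ?_, fun u => ?_⟩, hbd, fun f τ hτ => ?_⟩
  · rw [hval, hR, ← graphMap_apply, hS]
  · have hu : ((u : L2), H0 u) ∈ closedGraph := by rw [← graph_H0]; exact H0.mem_graph u
    have h1 : S.symm (H0 u - z • (u : L2)) = ⟨((u : L2), H0 u), hu⟩ := by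
      rw [LinearEquiv.symm_apply_eq]; rfl
    rw [hR, h1]
  · have hx : (S.symm f : L2 × L2) ∈ closure (H0min.graph : Set (L2 × L2)) := (S.symm f).2
    have hc : 0 < τ / (1 + ‖z‖) := by positivity
    obtain ⟨y, hy, hd⟩ := Metric.mem_closure_iff.1 hx _ hc
    obtain ⟨u, rfl⟩ := mem_graph_H0min.1 hy
    rw [dist_comm, dist_eq_norm, Prod.norm_def] at hd
    have hd1 := (le_max_left _ _).trans hd.le
    have hd2 := (le_max_right _ _).trans hd.le
    simp only [Prod.fst_sub, Prod.snd_sub] at hd1 hd2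
    have e : τ = τ / (1 + ‖z‖) + ‖z‖ * (τ / (1 + ‖z‖)) := by field_simp
    refine ⟨u, hd1.trans ?_, ?_⟩
    · have : 0 ≤ ‖z‖ * (τ / (1 + ‖z‖)) := by positivity
      linarith
    · have e2 : toL2 (shifted z u) - f = (toL2 (exprLin u) - (S.symm f : L2 × L2).2) -
          z • (toL2 u - (S.symm f : L2 × L2).1) := by
        conv_lhs => rw [← hS f]
        rw [graphMap_apply, toL2_shifted, smul_sub]
        abel
      rw [e2, e]
      refine (norm_sub_le _ _).trans (add_le_add hd2 ?_)
      rw [norm_smul]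
      exact mul_le_mul_of_nonneg_left hd1 (norm_nonneg _)

/-! ### The weighted resolvent estimate -/

theorem weight_eq (δ : ℝ) (p : ℝ × ℝ) : weight δ p = weight 1 p ^ δ := by
  have h := one_le_bracket (radius p)
  rw [weight, weight, ← Real.rpow_mul (by linarith), neg_mul, one_mul]

theorem weight_one_eq (p : ℝ × ℝ) : weight 1 p = chiFn.1 p := by
  change Real.sqrt (1 + (Real.sqrt (p.1 ^ 2 + p.2 ^ 2)) ^ 2) ^ (-1 : ℝ) =
    (√(1 + (p.1 ^ 2 + p.2 ^ 2)))⁻¹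
  rw [Real.sq_sqrt (by positivity), Real.rpow_neg_one]

theorem coeFn_weightOp {δ : ℝ} (hδ : 0 ≤ δ) (f : L2) :
    weightOp δ hδ f =ᵐ[volume] fun p => (weight δ p : ℂ) * f p :=
  (memLp_weight_mul hδ f).coeFn_toLp

theorem weightOp_one_toL2 (φ : testSpace) :
    weightOp 1 zero_le_one (toL2 φ) = toL2 (mulL chiFn φ) := by
  refine Lp.ext ?_
  filter_upwards [coeFn_weightOp zero_le_one (toL2 φ), (memLp_of_mem φ.2).coeFn_toLp,
    (memLp_of_mem (mulL chiFn φ).2).coeFn_toLp] with p h1 h2 h3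
  rw [h1]
  change (weight 1 p : ℂ) * (memLp_of_mem φ.2).toLp φ.1 p =
    (memLp_of_mem (mulL chiFn φ).2).toLp _ p
  rw [h2, h3, weight_one_eq]
  rfl

theorem norm_weightOp_apply_le {δ : ℝ} (hδ : 0 ≤ δ) (f : L2) : ‖weightOp δ hδ f‖ ≤ ‖f‖ := by
  refine Lp.norm_le_norm_of_ae_le ?_
  filter_upwards [coeFn_weightOp hδ f] with p hp
  rw [hp]
  exact norm_weight_mul_le hδ p (f p)

theorem denseRange_toL2 : DenseRange toL2 := by
  have h : (LinearMap.range toL2).topologicalClosure = ⊤ := by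
    rw [Submodule.topologicalClosure_eq_top_iff, Submodule.eq_bot_iff]
    intro v hv
    refine eq_zero_of_inner_toL2_eq_zero v fun φ => ?_
    rw [inner_eq_zero_symm]
    exact (Submodule.mem_orthogonal _ v).1 hv _ ⟨φ, rfl⟩
  exact Submodule.dense_iff_topologicalClosure_eq_top.2 h

theorem norm_weightOp_one_resolvent_le {z : ℂ} (hz : 0 < z.im) (hz1 : z.im ≤ 1)
    (hL : 1 ≤ |z.re|) {R : L2 →L[ℂ] L2}
    (happ : ∀ f : L2, ∀ τ : ℝ, 0 < τ → ∃ u : testSpace,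
        ‖toL2 u - R f‖ ≤ τ ∧ ‖toL2 (shifted z u) - f‖ ≤ τ) (g : L2) :
    √|z.re| * ‖weightOp 1 zero_le_one (R (weightOp 1 zero_le_one g))‖ ≤
      1000 * 30 ^ 3 * (‖g‖ / z.im) := by
  refine denseRange_toL2.induction_on
    (p := fun g => √|z.re| * ‖weightOp 1 zero_le_one (R (weightOp 1 zero_le_one g))‖ ≤
      1000 * 30 ^ 3 * (‖g‖ / z.im)) g (isClosed_le (by fun_prop) (by fun_prop)) fun g => ?_
  have hs : 0 < √|z.re| := Real.sqrt_pos.2 (by linarith)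
  rcases (norm_nonneg (toL2 g)).eq_or_lt' with h0 | h0
  · rw [norm_eq_zero.1 h0]; simp
  rw [weightOp_one_toL2]
  refine le_of_forall_pos_le_add fun τ hτ => ?_
  set κ := min (τ / √|z.re|) (z.im / √|z.re| * ‖toL2 g‖) with hκ
  have hκ0 : 0 < κ := lt_min (by positivity) (by positivity)
  obtain ⟨u, hu1, hu2⟩ := happ (toL2 (mulL chiFn g)) κ hκ0
  have hmain := (admissible hL).norm_mulL_le_of_shifted_eq hL rfl hz hz1 u g
    (shifted z u - mulL chiFn g) (by abel) (by
      rw [map_sub]; exact hu2.trans (min_le_right _ _))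
  have h1 : ‖weightOp 1 zero_le_one (R (toL2 (mulL chiFn g)))‖ ≤ ‖toL2 (mulL chiFn u)‖ + κ := by
    have e : weightOp 1 zero_le_one (R (toL2 (mulL chiFn g))) = toL2 (mulL chiFn u) -
        weightOp 1 zero_le_one (toL2 u - R (toL2 (mulL chiFn g))) := by
      rw [map_sub, weightOp_one_toL2, sub_sub_cancel]
    rw [e]
    exact (norm_sub_le _ _).trans (add_le_add le_rfl ((norm_weightOp_apply_le _ _).trans hu1))
  calc _ ≤ √|z.re| * (‖toL2 (mulL chiFn u)‖ + κ) := mul_le_mul_of_nonneg_left h1 hs.le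
    _ = √|z.re| * ‖toL2 (mulL chiFn u)‖ + √|z.re| * κ := by ring
    _ ≤ 1000 * 30 ^ 3 * (‖toL2 g‖ / z.im) + τ := by
        refine add_le_add hmain ?_
        calc √|z.re| * κ ≤ √|z.re| * (τ / √|z.re|) :=
              mul_le_mul_of_nonneg_left (min_le_left _ _) hs.le
          _ = τ := by field_simp

/-! ### Weights of arbitrary order -/

theorem exists_ae_eq_mul {m : ℝ × ℝ → ℝ} (hm : Measurable m) {c : ℝ} (hc : ∀ p, |m p| ≤ c)
    (f : L2) : ∃ k : L2, k =ᵐ[volume] fun p => (m p : ℂ) * f p := by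
  have h : MemLp (fun p => (m p : ℂ) * f p) 2 volume := by
    refine (Lp.memLp f).of_le_mul (c := c)
      ((Complex.measurable_ofReal.comp hm).aestronglyMeasurable.mul (Lp.aestronglyMeasurable f))
      (Filter.Eventually.of_forall fun p => ?_)
    rw [norm_mul, Complex.norm_real]
    exact mul_le_mul_of_nonneg_right (hc p) (norm_nonneg _)
  exact ⟨h.toLp _, h.coeFn_toLp⟩

theorem weight_one_pos (p : ℝ × ℝ) : 0 < weight 1 p :=
  Real.rpow_pos_of_pos (by linarith [one_le_bracket (radius p)]) _

theorem exists_weightOp_split {δ μ : ℝ} (hδ : 0 ≤ δ) (hμ : 0 < μ) (f : L2) :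
    ∃ k m : L2, weightOp δ hδ f = weightOp 1 zero_le_one k + m ∧
      ‖k‖ ≤ max 1 (μ ^ (δ - 1)) * ‖f‖ ∧ ‖m‖ ≤ μ ^ δ * ‖f‖ ∧
      ‖weightOp 1 zero_le_one k‖ ≤ ‖f‖ ∧
      ‖weightOp 1 zero_le_one k‖ ≤ max 1 (μ ^ (δ - 1)) * ‖weightOp 1 zero_le_one f‖ := by
  set B := max 1 (μ ^ (δ - 1)) with hB
  set S : Set (ℝ × ℝ) := {p | μ ≤ weight 1 p} with hS
  have hSm : MeasurableSet S := measurableSet_le measurable_const (measurable_weight 1)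
  set m₁ : ℝ × ℝ → ℝ := S.indicator fun p => weight 1 p ^ (δ - 1) with hm₁
  set m₂ : ℝ × ℝ → ℝ := Sᶜ.indicator fun p => weight 1 p ^ δ with hm₂
  have hw1 : ∀ p, weight 1 p ≤ 1 := weight_le_one zero_le_one
  have hm₁m : Measurable m₁ := ((measurable_weight 1).pow_const _).indicator hSm
  have hm₂m : Measurable m₂ := ((measurable_weight 1).pow_const _).indicator hSm.compl
  have b₁ : ∀ p, |m₁ p| ≤ B := by
    intro p
    by_cases hp : p ∈ S
    · rw [hm₁, Set.indicator_of_mem hp, abs_of_pos (Real.rpow_pos_of_pos (weight_one_pos p) _)]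
      rcases le_total 1 δ with h | h
      · exact (Real.rpow_le_one (weight_one_pos p).le (hw1 p) (by linarith)).trans (le_max_left _ _)
      · exact (Real.rpow_le_rpow_of_nonpos hμ hp (by linarith)).trans (le_max_right _ _)
    · rw [hm₁, Set.indicator_of_notMem hp, abs_zero]
      exact zero_le_one.trans (le_max_left _ _)
  have b₂ : ∀ p, |m₂ p| ≤ μ ^ δ := by
    intro p
    by_cases hp : p ∈ S
    · rw [hm₂, Set.indicator_of_notMem (Set.notMem_compl_iff.2 hp), abs_zero]
      positivity
    · rw [hm₂, Set.indicator_of_mem hp, abs_of_pos (Real.rpow_pos_of_pos (weight_one_pos p) _)]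
      exact Real.rpow_le_rpow (weight_one_pos p).le (not_le.1 hp).le hδ
  have split : ∀ p, weight δ p = weight 1 p * m₁ p + m₂ p := by
    intro p
    rw [weight_eq]
    by_cases hp : p ∈ S
    · rw [hm₁, hm₂, Set.indicator_of_mem hp,
        Set.indicator_of_notMem (Set.notMem_compl_iff.2 hp), add_zero,
        Real.rpow_sub_one (weight_one_pos p).ne', mul_div_cancel₀ _ (weight_one_pos p).ne']
    · rw [hm₁, hm₂, Set.indicator_of_notMem hp, Set.indicator_of_mem hp, mul_zero, zero_add]
  have hm₁0 : ∀ p, 0 ≤ m₁ p := fun p =>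
    Set.indicator_nonneg (fun q _ => (Real.rpow_pos_of_pos (weight_one_pos q) _).le) p
  have hm₂0 : ∀ p, 0 ≤ m₂ p := fun p =>
    Set.indicator_nonneg (fun q _ => (Real.rpow_pos_of_pos (weight_one_pos q) _).le) p
  obtain ⟨k, hk⟩ := exists_ae_eq_mul hm₁m b₁ f
  obtain ⟨m, hm⟩ := exists_ae_eq_mul hm₂m b₂ f
  refine ⟨k, m, ?_, ?_, ?_, ?_, ?_⟩
  · refine Lp.ext ?_
    filter_upwards [hk, hm, coeFn_weightOp hδ f, coeFn_weightOp zero_le_one k,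
      Lp.coeFn_add (weightOp 1 zero_le_one k) m] with p h1 h2 h3 h4 h5
    rw [h3, h5, Pi.add_apply, h4, h1, h2, split p]
    push_cast
    ring
  · refine Lp.norm_le_mul_norm_of_ae_le_mul ?_
    filter_upwards [hk] with p h1
    rw [h1, norm_mul, Complex.norm_real]
    exact mul_le_mul_of_nonneg_right (b₁ p) (norm_nonneg _)
  · refine Lp.norm_le_mul_norm_of_ae_le_mul ?_
    filter_upwards [hm] with p h1
    rw [h1, norm_mul, Complex.norm_real]
    exact mul_le_mul_of_nonneg_right (b₂ p) (norm_nonneg _)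
  · refine Lp.norm_le_norm_of_ae_le ?_
    filter_upwards [hk, coeFn_weightOp zero_le_one k] with p h1 h4
    rw [h4, h1, ← mul_assoc, ← Complex.ofReal_mul, norm_mul, Complex.norm_real,
      Real.norm_of_nonneg (mul_nonneg (weight_one_pos p).le (hm₁0 p))]
    refine mul_le_of_le_one_left (norm_nonneg _) ?_
    linarith [split p, weight_le_one hδ p, hm₂0 p]
  · refine Lp.norm_le_mul_norm_of_ae_le_mul ?_
    filter_upwards [hk, coeFn_weightOp zero_le_one k, coeFn_weightOp zero_le_one f] with p h1 h4 h6
    rw [h4, h1, h6, mul_left_comm, norm_mul, Complex.norm_real]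
    exact mul_le_mul_of_nonneg_right (b₁ p) (norm_nonneg _)

/-- The weighted resolvent estimate with the decay rate in the spectral parameter. -/
theorem norm_weighted_resolvent_le {z : ℂ} (hz : 0 < z.im) (hz1 : z.im ≤ 1) (hL : 1 ≤ |z.re|)
    {R : L2 →L[ℂ] L2} (hR : ∀ f, ‖R f‖ ≤ z.im⁻¹ * ‖f‖)
    (happ : ∀ f : L2, ∀ τ : ℝ, 0 < τ → ∃ u : testSpace,
        ‖toL2 u - R f‖ ≤ τ ∧ ‖toL2 (shifted z u) - f‖ ≤ τ)
    {δ : ℝ} (hδ : 0 < δ) (hδ2 : δ ≤ 2) :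
    ‖weightOp δ hδ.le ∘L R ∘L weightOp δ hδ.le‖ ≤
      (1000 * 30 ^ 3 + 2) * z.im⁻¹ * |z.re| ^ (-δ / 4) := by
  set L := |z.re| with hLdef
  have hL0 : 0 < L := by linarith
  set μ := L ^ (-(1 / 4) : ℝ) with hμdef
  have hμ : 0 < μ := Real.rpow_pos_of_pos hL0 _
  have hμ1 : μ ≤ 1 := Real.rpow_le_one_of_one_le_of_nonpos hL (by norm_num)
  have hμδ : μ ^ δ = L ^ (-δ / 4) := by
    rw [hμdef, ← Real.rpow_mul hL0.le]; congr 1; ring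
  have hμ2 : μ ^ 2 * √L = 1 := by
    rw [hμdef, ← Real.rpow_natCast, ← Real.rpow_mul hL0.le, Real.sqrt_eq_rpow,
      ← Real.rpow_add hL0]
    norm_num
  have hν : 0 < z.im⁻¹ := inv_pos.2 hz
  set B := max 1 (μ ^ (δ - 1)) with hB
  have hB0 : 0 ≤ B := zero_le_one.trans (le_max_left _ _)
  have hBμ : B ^ 2 * μ ^ 2 ≤ μ ^ δ := by
    have h1 : μ ^ 2 ≤ μ ^ δ := by
      rw [← Real.rpow_natCast]
      exact Real.rpow_le_rpow_of_exponent_ge hμ hμ1 (by exact_mod_cast hδ2)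
    rcases max_choice 1 (μ ^ (δ - 1)) with h | h
    · rw [hB, h, one_pow, one_mul]; exact h1
    · rw [hB, h, ← mul_pow, ← Real.rpow_add_one hμ.ne', sub_add_cancel, pow_two]
      exact mul_le_of_le_one_left (by positivity) (Real.rpow_le_one hμ.le hμ1 hδ.le)
  rw [← hμδ]
  refine ContinuousLinearMap.opNorm_le_bound _ (by positivity) fun g => ?_
  change ‖weightOp δ hδ.le (R (weightOp δ hδ.le g))‖ ≤ _
  obtain ⟨k, m, e, hk, hm, hWk, -⟩ := exists_weightOp_split hδ.le hμ g
  set f := R (weightOp 1 zero_le_one k) with hf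
  obtain ⟨k', m', e', -, hm', -, hWk'⟩ := exists_weightOp_split hδ.le hμ f
  have hend : ‖weightOp 1 zero_le_one f‖ ≤ 1000 * 30 ^ 3 * μ ^ 2 * z.im⁻¹ * (B * ‖g‖) := by
    have h1 := norm_weightOp_one_resolvent_le hz hz1 hL happ k
    have h2 : ‖weightOp 1 zero_le_one f‖ = μ ^ 2 * (√L * ‖weightOp 1 zero_le_one f‖) := by
      rw [← mul_assoc, hμ2, one_mul]
    rw [h2]
    calc _ ≤ μ ^ 2 * (1000 * 30 ^ 3 * (‖k‖ / z.im)) := mul_le_mul_of_nonneg_left h1 (by positivity)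
      _ = 1000 * 30 ^ 3 * μ ^ 2 * z.im⁻¹ * ‖k‖ := by rw [div_eq_mul_inv]; ring
      _ ≤ _ := mul_le_mul_of_nonneg_left hk (by positivity)
  have hfn : ‖f‖ ≤ z.im⁻¹ * ‖g‖ := (hR _).trans (mul_le_mul_of_nonneg_left hWk hν.le)
  have hRm : ‖R m‖ ≤ z.im⁻¹ * (μ ^ δ * ‖g‖) := (hR _).trans (mul_le_mul_of_nonneg_left hm hν.le)
  have h1 : ‖weightOp δ hδ.le f‖ ≤
      B * (1000 * 30 ^ 3 * μ ^ 2 * z.im⁻¹ * (B * ‖g‖)) + μ ^ δ * (z.im⁻¹ * ‖g‖) := by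
    rw [e']
    refine (norm_add_le _ _).trans (add_le_add ?_ ?_)
    · exact hWk'.trans (mul_le_mul_of_nonneg_left hend hB0)
    · exact hm'.trans (mul_le_mul_of_nonneg_left hfn (by positivity))
  rw [e, map_add, map_add]
  have h2 := (norm_weightOp_apply_le hδ.le (R m)).trans hRm
  refine (norm_add_le _ _).trans ((add_le_add h1 h2).trans ?_)
  have h3 : 1000 * 30 ^ 3 * z.im⁻¹ * ‖g‖ * (B ^ 2 * μ ^ 2) ≤
      1000 * 30 ^ 3 * z.im⁻¹ * ‖g‖ * μ ^ δ :=
    mul_le_mul_of_nonneg_left hBμ (by positivity)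
  calc _ = 1000 * 30 ^ 3 * z.im⁻¹ * ‖g‖ * (B ^ 2 * μ ^ 2) + 2 * (μ ^ δ * z.im⁻¹ * ‖g‖) := by ring
    _ ≤ 1000 * 30 ^ 3 * z.im⁻¹ * ‖g‖ * μ ^ δ + 2 * (μ ^ δ * z.im⁻¹ * ‖g‖) := by linarith
    _ = _ := by ring

theorem exists_resolvent_weighted {δ ν lam : ℝ} (hδ : 0 < δ) (hδ2 : δ ≤ 2) (hν : 0 < ν)
    (hν1 : ν ≤ 1) (hlam : 1 ≤ |lam|) :
    ∃ R : L2 →L[ℂ] L2, IsResolvent H0 ((lam : ℂ) + (ν : ℂ) * Complex.I) R ∧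
      ‖weightOp δ hδ.le ∘L R ∘L weightOp δ hδ.le‖ ≤
        (1000 * 30 ^ 3 + 2) * ν⁻¹ * |lam| ^ (-δ / 4) := by
  have him : ((lam : ℂ) + (ν : ℂ) * Complex.I).im = ν := by simp
  have hre : ((lam : ℂ) + (ν : ℂ) * Complex.I).re = lam := by simp
  obtain ⟨R, h1, h2, h3⟩ := exists_isResolvent (z := (lam : ℂ) + (ν : ℂ) * Complex.I)
    (by rw [him]; exact hν)
  refine ⟨R, h1, ?_⟩
  have := norm_weighted_resolvent_le (by rw [him]; exact hν) (by rw [him]; exact hν1)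
    (by rw [hre]; exact hlam) h2 h3 hδ hδ2
  rwa [him, hre] at this

end LandauStark

end

theorem proposition3p1 :
    (∀ θ : ℝ, 0 < θ → θ ≤ 1 / 2 →
      ∃ C : ℝ, 0 < C ∧
        ∀ (δ : ℝ) (hδ : 0 < δ), δ ≤ 2 →
        ∀ ν : ℝ, 0 < ν → ν ≤ 1 →
        ∀ lam : ℝ, 1 ≤ |lam| →
          ∃ R : LandauStark.L2 →L[ℂ] LandauStark.L2,
            LandauStark.IsResolvent LandauStark.H0 ((lam : ℂ) + (ν : ℂ) * Complex.I) R ∧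
            ‖LandauStark.weightOp δ hδ.le ∘L R ∘L LandauStark.weightOp δ hδ.le‖ ≤
              C * ν⁻¹ *
                (|lam| ^ (-θ) + (1 + ν) * |lam| ^ (-1 : ℝ) +
                  (1 + ν ^ (-2 : ℝ)) * |lam| ^ (θ - 1)) ^ (δ / 2)) ∧
    (∃ C : ℝ, 0 < C ∧
        ∀ (δ : ℝ) (hδ : 0 < δ), δ ≤ 2 →
        ∀ ν : ℝ, 0 < ν → ν ≤ 1 →
        ∀ lam : ℝ, 1 ≤ |lam| →
          ∃ R : LandauStark.L2 →L[ℂ] LandauStark.L2,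
            LandauStark.IsResolvent LandauStark.H0 ((lam : ℂ) + (ν : ℂ) * Complex.I) R ∧
            ‖LandauStark.weightOp δ hδ.le ∘L R ∘L LandauStark.weightOp δ hδ.le‖ ≤
              C * ν ^ (-3 : ℝ) * |lam| ^ (-δ / 4)) := by
  constructor
  · intro θ hθ hθ2
    refine ⟨1000 * 30 ^ 3 + 2, by norm_num, fun δ hδ hδ2 ν hν hν1 lam hlam => ?_⟩
    obtain ⟨R, h1, h2⟩ := LandauStark.exists_resolvent_weighted hδ hδ2 hν hν1 hlam
    refine ⟨R, h1, h2.trans (mul_le_mul_of_nonneg_left ?_ (by positivity))⟩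
    have hl : 0 < |lam| := by linarith
    calc |lam| ^ (-δ / 4) = (|lam| ^ (-(1 / 2) : ℝ)) ^ (δ / 2) := by
          rw [← Real.rpow_mul hl.le]; congr 1; ring
      _ ≤ _ := by
          refine Real.rpow_le_rpow (by positivity) ?_ (by positivity)
          have h3 : |lam| ^ (-(1 / 2) : ℝ) ≤ |lam| ^ (-θ) :=
            Real.rpow_le_rpow_of_exponent_le hlam (by linarith)
          have h4 : 0 ≤ (1 + ν) * |lam| ^ (-1 : ℝ) := by positivity
          have h5 : 0 ≤ (1 + ν ^ (-2 : ℝ)) * |lam| ^ (θ - 1) := by positivity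
          linarith
  · refine ⟨1000 * 30 ^ 3 + 2, by norm_num, fun δ hδ hδ2 ν hν hν1 lam hlam => ?_⟩
    obtain ⟨R, h1, h2⟩ := LandauStark.exists_resolvent_weighted hδ hδ2 hν hν1 hlam
    refine ⟨R, h1, h2.trans (mul_le_mul_of_nonneg_right
      (mul_le_mul_of_nonneg_left ?_ (by norm_num)) (by positivity))⟩
    rw [← Real.rpow_neg_one]
    exact Real.rpow_le_rpow_of_exponent_ge hν hν1 (by norm_num)
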